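/- Let $n,s$ be integers with $0\le s<n$. An $(n,s)$-word is a binary word of length $n$ in which every run of consecutive zeros has length at most $s$. A cyclic (respectively acyclic) $(n,s)$-sequence is a cyclic (respectively acyclic) binary sequence whose windows of length $n$ (one at each position, read modulo the length of the sequence in the cyclic case; $k-n+1$ windows for an acyclic sequence of length $k\ge n$) are distinct $(n,s)$-words. The necklace of a binary word $w$ of length $n$ is the set of its cyclic shifts; the Lyndon word (of order $n$) of a necklace with $d$ elements consists of the first $d$ bits of its least element. Consider the following algorithm. Start with $Y=y_1\cdots y_n=0^{s+1}1^{n-s-1}$ and an empty list. While $Y\ne 1^n$, let $j$ be the largest index with $y_j=0$, let $Z=y_1\cdots y_{j-1}1$, replace $Y$ by the first $n$ bits of $ZZZ\cdots$, and, if $j$ divides $n$, append $Z$ to the list. Theorem. The algorithm terminates, and its list $X_1,X_2,\dots,X_i$ consists of exactly the Lyndon words of order $n$ that come after $0^{s+1}1^{n-s-1}$ lexicographically, in increasing lexicographic order. The concatenation $[X_1X_2\cdots X_i]$ is a cyclic $(n,s)$-sequence of maximum length. If moreover $s<n-1$, then $0^s1^{n-s-1}X_1X_2\cdots X_i0^s$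 is an acyclic $(n,s)$-sequence of maximum length. -/

import Mathlib

/-!
Binary words are lists of Booleans, with `false` for the bit 0 and `true` for the bit 1, so that
the order `<` on `List Bool` is the lexicographic order.
-/

/-- An `(n,s)`-word: a binary word of length `n` in which every run of zeros has length at
most `s`. -/
def IsNSWord (n s : ℕ) (w : List Bool) : Prop :=
  w.length = n ∧ ∀ r : ℕ, List.replicate r false <:+: w → r ≤ s

/-- The window of length `n` at position `i` of the cyclic sequence `[l]`. Indices are taken modulo
the length of `l`, which may be smaller than `n`. -/
def cyclicWindow (n : ℕ) (l : List Bool) (i : ℕ) : List Bool :=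
  List.ofFn fun j : Fin n => l.getD ((i + j) % l.length) false

/-- The cyclic sequence `[l]`, of length `k = l.length`, is an `(n,s)`-sequence: its `k` windows of
length `n` are distinct `(n,s)`-words. -/
def IsCyclicNSSequence (n s : ℕ) (l : List Bool) : Prop :=
  (∀ i < l.length, IsNSWord n s (cyclicWindow n l i)) ∧
    ∀ i < l.length, ∀ j < l.length, cyclicWindow n l i = cyclicWindow n l j → i = j

/-- The window of length `n` at position `i` of the acyclic sequence `l`; it is a word of length `n`
when `i + n ≤ l.length`. -/
def acyclicWindow (n : ℕ) (l : List Bool) (i : ℕ) : List Bool :=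
  (l.drop i).take n

/-- The acyclic sequence `l`, of length `k = l.length`, is an `(n,s)`-sequence: its `k - n + 1`
windows of length `n` are distinct `(n,s)`-words. -/
def IsAcyclicNSSequence (n s : ℕ) (l : List Bool) : Prop :=
  (∀ i, i + n ≤ l.length → IsNSWord n s (acyclicWindow n l i)) ∧
    ∀ i j, i + n ≤ l.length → j + n ≤ l.length →
      acyclicWindow n l i = acyclicWindow n l j → i = j

/-- `[l]` is a cyclic `(n,s)`-sequence of maximum length. -/
def IsMaxCyclicNSSequence (n s : ℕ) (l : List Bool) : Prop :=
  IsCyclicNSSequence n s l ∧ ∀ l', IsCyclicNSSequence n s l' → l'.length ≤ l.length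

/-- `l` is an acyclic `(n,s)`-sequence of maximum length. -/
def IsMaxAcyclicNSSequence (n s : ℕ) (l : List Bool) : Prop :=
  IsAcyclicNSSequence n s l ∧ ∀ l', IsAcyclicNSSequence n s l' → l'.length ≤ l.length

/-- The necklace of a word `w`: the set of its cyclic shifts. -/
def necklace (w : List Bool) : Set (List Bool) :=
  {v | w ~r v}

/-- `x` is the Lyndon word of some necklace of order `n`: if `w` is the least word of the necklace
and the necklace has `d` elements, then `x` consists of the first `d` bits of `w` (so `x = w` for a
necklace of full order, and `x` is one period of `w` for a degenerated one). -/
def IsLyndonWordOfOrder (n : ℕ) (x : List Bool) : Prop :=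
  ∃ w : List Bool, w.length = n ∧ (∀ v ∈ necklace w, w ≤ v) ∧ x = w.take (necklace w).ncard

/-- The word `0^{s+1} 1^{n-s-1}`. -/
def initialWord (n s : ℕ) : List Bool :=
  List.replicate (s + 1) false ++ List.replicate (n - s - 1) true

/-- The largest position `t ∈ {1, …, |Y|}` with `y_t = 0`, for `Y = y_1 y_2 ⋯`. -/
def lastZero (Y : List Bool) : ℕ :=
  ((Finset.Icc 1 Y.length).filter fun t => Y[t - 1]? = some false).sup id

/-- One execution of the body of the `while` loop of the algorithm. A state consists of the word `Y`
and of the list `X_1, …, X_i` of the words computed so far. With `j` the position of the last zero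
of `Y`, put `Z = y_1 ⋯ y_{j-1} 1`, replace `Y` by the first `n` bits of `Z Z Z ⋯`, and append `Z` to
the list if `j` divides `n`. -/
def loopBody (n : ℕ) (σ : List Bool × List (List Bool)) : List Bool × List (List Bool) :=
  let j := lastZero σ.1
  let Z := σ.1.take (j - 1) ++ [true]
  ((List.replicate n Z).flatten.take n, if j ∣ n then σ.2 ++ [Z] else σ.2)

/-- The algorithm, started with `Y = 0^{s+1} 1^{n-s-1}` and the empty list, and running
`while Y ≠ 1^n`, stops (after `t` executions of the loop body) with the list `X = X_1, …, X_i`. -/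
def AlgorithmComputes (n s : ℕ) (X : List (List Bool)) : Prop :=
  ∃ t : ℕ, (loopBody n)^[t] (initialWord n s, []) = (List.replicate n true, X) ∧
    ∀ u < t, ((loopBody n)^[u] (initialWord n s, [])).1 ≠ List.replicate n true

/-! Call a word a prenecklace if no suffix is smaller than the prefix of the same length (`IsPre`).
If Y = y01^r is a prenecklace, then Z = y1 is Lyndon and the first n bits of ZZZ⋯ form the least
prenecklace above Y (`isPre_ext`, `ext_le_of_lt`); this is a necklace exactly when |Z| divides n. So
the loop visits the prenecklaces of length n in increasing order and records the Lyndon root of each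
necklace (`exists_run`).

In the concatenation of the roots, a necklace y01^r is followed by one that starts with y1, because
y11^r is again a necklace. Hence each necklace other than 1^n can be read off where its root begins,
and every rotation of a listed necklace is a cyclic window (`IsUpper.exists_cyclicWindow`). There
are as many such rotations as bits, so each occurs exactly once (`IsUpper.windows_perm`). As
0^{s+1}1^{n-s-1} is the largest word of length n starting with 0^{s+1}, the windows are the words no
rotation of which starts with 0^{s+1}; among them are all (n,s)-words starting with 1.

This last fact gives maximality (`card_le_of_windows`). From a position p of a competing sequence,
step back e ≤ s places to the nearest 1. The window there starts with 10^e and occurs in the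
constructed sequence, say at a. Then p ↦ a + e is injective, since e is the distance from a + e back
to the nearest 1. In the acyclic case at most s window positions must be discarded first. The
acyclic sequence is the cyclic one unrolled, preceded by the s extra windows
0^{s-i}1^{n-s-1}0^{i+1}. -/

namespace BinWord

/-! ### The lexicographic order on binary words -/

theorem nil_le (v : List Bool) : [] ≤ v :=
  not_lt.1 (List.not_lt_nil v)

theorem cons_le_cons_iff {a b : Bool} {u v : List Bool} :
    a :: u ≤ b :: v ↔ a < b ∨ a = b ∧ u ≤ v := by
  rw [← not_lt, List.cons_lt_cons_iff, ← not_lt (a := v)]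
  rcases lt_trichotomy a b with h | rfl | h
  · simp [h, h.not_gt, h.ne']
  · simp
  · simp [h, h.not_gt, h.ne']

theorem append_lt_append_iff (u a b : List Bool) : u ++ a < u ++ b ↔ a < b := by
  induction u with
  | nil => simp
  | cons c u ih => simp [ih]

theorem append_le_append_iff (u a b : List Bool) : u ++ a ≤ u ++ b ↔ a ≤ b := by
  rw [← not_lt, append_lt_append_iff, not_lt]

theorem take_le_take_of_le {u v : List Bool} (h : u ≤ v) (k : ℕ) : u.take k ≤ v.take k := by
  induction k generalizing u v with
  | zero => simp
  | succ k ih =>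
    cases u with
    | nil => exact nil_le _
    | cons a u =>
      cases v with
      | nil => exact absurd h (not_le.2 (List.nil_lt_cons a u))
      | cons b v =>
        rw [cons_le_cons_iff] at h
        simp only [List.take_succ_cons]
        rw [cons_le_cons_iff]
        rcases h with h | ⟨rfl, h⟩
        · exact Or.inl h
        · exact Or.inr ⟨rfl, ih h⟩

theorem lt_of_take_lt_take {u v : List Bool} {k : ℕ} (h : u.take k < v.take k) : u < v :=
  lt_of_not_ge fun h' => absurd h (not_lt.2 (take_le_take_of_le h' k))

theorem le_of_prefix {u v : List Bool} (h : u <+: v) : u ≤ v := by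
  obtain ⟨t, rfl⟩ := h
  have := (append_le_append_iff u [] t).2 (nil_le t)
  simpa using this

theorem append_false_lt_append_true (y a b : List Bool) : y ++ false :: a < y ++ true :: b := by
  rw [append_lt_append_iff, List.cons_lt_cons_iff]
  exact Or.inl (by decide)

theorem le_replicate_true (v : List Bool) (n : ℕ) (h : v.length ≤ n) :
    v ≤ List.replicate n true := by
  induction v generalizing n with
  | nil => exact nil_le _
  | cons a v ih =>
    cases n with
    | zero => simp at h
    | succ n =>
      rw [List.replicate_succ, cons_le_cons_iff]
      cases a with
      | false => exact Or.inl (by decide)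
      | true => exact Or.inr ⟨rfl, ih n (by simpa using h)⟩

theorem exists_last_zero {Y : List Bool} (h : Y ≠ List.replicate Y.length true) :
    ∃ y r, Y = y ++ false :: List.replicate r true := by
  induction Y using List.reverseRecOn with
  | nil => simp at h
  | append_singleton Y c ih =>
    cases c with
    | false => exact ⟨Y, 0, by simp⟩
    | true =>
      obtain ⟨y, r, hy⟩ := ih (by
        intro h'
        apply h
        rw [List.length_append, List.length_singleton, List.replicate_succ', ← h'])
      exact ⟨y, r + 1, by rw [List.replicate_succ', hy]; simp⟩

theorem last_zero_unique {y y' : List Bool} {r r' : ℕ}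
    (h : y ++ false :: List.replicate r true = y' ++ false :: List.replicate r' true) :
    y = y' ∧ r = r' := by
  wlog hrr : r ≤ r' generalizing y y' r r'
  · have := this h.symm (by omega)
    exact ⟨this.1.symm, this.2.symm⟩
  obtain ⟨m, rfl⟩ := Nat.exists_eq_add_of_le hrr
  rw [add_comm r m, ← List.replicate_append_replicate, ← List.cons_append, ← List.append_assoc,
    List.append_cons] at h
  have h1 := List.append_cancel_right h
  cases m with
  | zero => simpa using h1
  | succ m =>
    rw [List.replicate_succ', ← List.cons_append, ← List.append_assoc] at h1
    have := (List.append_inj' h1 rfl).2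
    simp at this

/-! ### Prenecklaces, Lyndon words, necklaces -/

/-- Every suffix is at least the prefix of the same length. -/
def IsPre (Y : List Bool) : Prop :=
  ∀ a b, a ++ b = Y → Y.take b.length ≤ b

/-- Every proper nonempty suffix is greater than the prefix of the same length. -/
def IsLyn (Z : List Bool) : Prop :=
  Z ≠ [] ∧ ∀ a b, a ++ b = Z → a ≠ [] → b ≠ [] → Z.take b.length < b

/-- The word is the least element of its necklace. -/
def IsNeck (w : List Bool) : Prop :=
  ∀ v, w ~r v → w ≤ v

/-- The first `n` letters of `Z Z Z ⋯`. -/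
def ext (n : ℕ) (Z : List Bool) : List Bool :=
  (List.replicate n Z).flatten.take n

/-- The power `Z ^ k`. -/
def pow (Z : List Bool) (k : ℕ) : List Bool :=
  (List.replicate k Z).flatten

theorem pow_succ (Z : List Bool) (k : ℕ) : pow Z (k + 1) = Z ++ pow Z k := by
  simp [pow, List.replicate_succ]

theorem pow_succ' (Z : List Bool) (k : ℕ) : pow Z (k + 1) = pow Z k ++ Z := by
  simp [pow, List.replicate_succ']

theorem length_pow (Z : List Bool) (k : ℕ) : (pow Z k).length = k * Z.length := by
  simp [pow]

theorem pow_add (Z : List Bool) (k l : ℕ) : pow Z (k + l) = pow Z k ++ pow Z l := by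
  rw [pow, ← List.replicate_append_replicate, List.flatten_append]; rfl

theorem take_pow {Z : List Bool} {m k l : ℕ} (hk : m ≤ k * Z.length) (hl : m ≤ l * Z.length) :
    (pow Z k).take m = (pow Z l).take m := by
  have key : ∀ a b, m ≤ a * Z.length → (pow Z (a + b)).take m = (pow Z a).take m := by
    intro a b h
    rw [pow_add, List.take_append_of_le_length (by rwa [length_pow])]
  rcases le_total k l with h | h
  · obtain ⟨b, rfl⟩ := Nat.exists_eq_add_of_le h
    exact (key k b hk).symm
  · obtain ⟨b, rfl⟩ := Nat.exists_eq_add_of_le h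
    exact key l b hl

theorem ext_eq {Z : List Bool} (hZ : Z ≠ []) {n k : ℕ} (hk : n ≤ k * Z.length) :
    ext n Z = (pow Z k).take n :=
  take_pow (Nat.le_mul_of_pos_right _ (List.length_pos_iff.2 hZ)) hk

theorem length_ext {Z : List Bool} (hZ : Z ≠ []) (n : ℕ) : (ext n Z).length = n := by
  have : n ≤ n * Z.length := Nat.le_mul_of_pos_right _ (List.length_pos_iff.2 hZ)
  rw [ext_eq hZ this, List.length_take, length_pow]
  omega

theorem ext_mul {Z : List Bool} (hZ : Z ≠ []) (k : ℕ) : ext (k * Z.length) Z = pow Z k := by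
  rw [ext_eq hZ le_rfl, List.take_of_length_le (by rw [length_pow])]

theorem ext_of_le {Z : List Bool} (hZ : Z ≠ []) {n : ℕ} (h : n ≤ Z.length) :
    ext n Z = Z.take n := by
  rw [ext_eq hZ (k := 1) (by simpa using h)]
  simp [pow]

theorem ext_add {Z : List Bool} (hZ : Z ≠ []) (n : ℕ) :
    ext (Z.length + n) Z = Z ++ ext n Z := by
  have h : n ≤ n * Z.length := Nat.le_mul_of_pos_right _ (List.length_pos_iff.2 hZ)
  rw [ext_eq hZ h, ext_eq hZ (k := n + 1) (by rw [Nat.add_mul]; omega), pow_succ,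
    List.take_append, List.take_of_length_le (by omega)]
  simp

theorem ext_prefix_ext {Z : List Bool} (hZ : Z ≠ []) {m n : ℕ} (h : m ≤ n) :
    ext m Z <+: ext n Z := by
  have hn : n ≤ n * Z.length := Nat.le_mul_of_pos_right _ (List.length_pos_iff.2 hZ)
  rw [ext_eq hZ hn, ext_eq hZ (h.trans hn)]
  exact List.take_prefix_take_left h

theorem prefix_ext {Z : List Bool} (hZ : Z ≠ []) {n : ℕ} (h : Z.length ≤ n) : Z <+: ext n Z := by
  have := ext_prefix_ext hZ h
  rwa [ext_of_le hZ le_rfl, List.take_length] at this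

theorem IsPre.of_prefix {Y U : List Bool} (h : IsPre Y) (hU : U <+: Y) : IsPre U := by
  obtain ⟨c, rfl⟩ := hU
  rintro a b rfl
  have := take_le_take_of_le (h a (b ++ c) (by simp)) b.length
  rw [List.take_take, List.take_left, List.length_append, min_eq_left (by omega),
    List.take_append_of_le_length (by simp)] at this
  exact this

theorem IsNeck.isPre {w : List Bool} (h : IsNeck w) : IsPre w := by
  rintro a b rfl
  have := take_le_take_of_le (h (b ++ a) List.isRotated_append) b.length
  rwa [List.take_left] at this

theorem IsLyn.isPre {Z : List Bool} (h : IsLyn Z) : IsPre Z := by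
  rintro a b hab
  rcases eq_or_ne a [] with rfl | ha
  · simp at hab; simp [hab]
  rcases eq_or_ne b [] with rfl | hb
  · simp
  exact (h.2 a b hab ha hb).le

theorem IsLyn.lt_rotate {Z : List Bool} (h : IsLyn Z) {a b : List Bool} (hab : a ++ b = Z)
    (ha : a ≠ []) (hb : b ≠ []) (c d : List Bool) : Z ++ c < b ++ d := by
  refine lt_of_take_lt_take (k := b.length) ?_
  have hl : b.length ≤ Z.length := by rw [← hab]; simp
  rw [List.take_left, List.take_append_of_le_length hl]
  exact h.2 a b hab ha hb

/-- A proper suffix of y1 has the form b1, where b0 is a suffix of the prenecklace y0 and so is at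
least the prefix of its length. That prefix lies inside y and is unaffected by the change of the
last bit, while b0 < b1. -/
theorem IsPre.isLyn_append_true {y c : List Bool} (h : IsPre (y ++ false :: c)) :
    IsLyn (y ++ [true]) := by
  refine ⟨by simp, ?_⟩
  intro a b hab ha hb
  obtain ⟨b', x, rfl⟩ := List.eq_nil_or_concat b |>.resolve_left hb
  rw [List.concat_eq_append, ← List.append_assoc] at hab
  obtain ⟨hy, hx⟩ := List.append_inj' hab rfl
  simp only [List.cons.injEq, and_true] at hx
  subst hx
  have hp : IsPre (y ++ [false]) := h.of_prefix ⟨c, by simp⟩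
  have h1 := hp a (b' ++ [false]) (by rw [← hy]; simp)
  have hl : b'.length + 1 ≤ y.length := by
    have := List.length_pos_iff.2 ha
    rw [← hy, List.length_append]; omega
  rw [List.take_append_of_le_length (by simpa using hl)] at h1
  rw [List.concat_eq_append, List.take_append_of_le_length (by simpa using hl)]
  simp only [List.length_append, List.length_singleton] at h1 ⊢
  exact h1.trans_lt (append_false_lt_append_true b' [] [])

theorem IsPre.head_false {y c : List Bool} (h : IsPre (y ++ false :: c)) (b : Bool)
    (t : List Bool) (hy : y = b :: t) : b = false := by
  subst hy
  by_contra hb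
  simp only [Bool.not_eq_false] at hb
  subst hb
  have := take_le_take_of_le (h (true :: t) (false :: c) rfl) 1
  simp [List.take_take] at this
  exact absurd this (by decide)

theorem IsLyn.isNeck {Z : List Bool} (h : IsLyn Z) : IsNeck Z := by
  rintro v ⟨k, rfl⟩
  rw [← List.rotate_mod, List.rotate_eq_drop_append_take (Nat.mod_lt _
    (List.length_pos_iff.2 h.1)).le]
  have hk := Nat.mod_lt k (List.length_pos_iff.2 h.1)
  generalize k % Z.length = i at hk
  rcases Nat.eq_zero_or_pos i with rfl | hi
  · simp
  have := h.lt_rotate (List.take_append_drop i Z) (by simp; exact ⟨by omega, h.1⟩)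
    (by simpa using hk) [] (Z.take i)
  simpa using this.le

/-- A suffix consisting of ones beats the leading 0; any longer suffix already wins before the
appended ones are reached. -/
theorem IsLyn.append_true {y : List Bool} (r : ℕ) (h : IsLyn (false :: y)) :
    IsLyn (false :: y ++ List.replicate r true) := by
  refine ⟨by simp, ?_⟩
  intro a b hab ha hb
  rw [List.append_eq_append_iff] at hab
  rcases hab with ⟨s, hs, rfl⟩ | ⟨s, hs, hs'⟩
  · rcases eq_or_ne s [] with rfl | hs0
    · cases r with
      | zero => simp at hb
      | succ r =>
        refine lt_of_take_lt_take (k := 1) ?_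
        simp only [List.nil_append, List.replicate_succ, List.length_cons, List.cons_append,
          List.take_succ_cons, List.take_zero]
        decide
    · exact lt_of_take_lt_take (k := s.length) (by
        rw [List.take_left, List.take_take, List.length_append, min_eq_left (by omega),
          List.take_append_of_le_length (by rw [hs]; simp)]
        exact h.2 a s hs.symm ha hs0)
  · cases b with
    | nil => simp at hb
    | cons x b =>
      have : x = true := by
        have : x ∈ List.replicate r true := by rw [hs']; simp
        exact List.eq_of_mem_replicate this
      subst this
      refine lt_of_take_lt_take (k := 1) ?_
      simp only [List.length_cons, List.cons_append, List.take_succ_cons, List.take_zero]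
      decide

theorem isNeck_replicate (n : ℕ) (c : Bool) : IsNeck (List.replicate n c) := by
  rintro v ⟨k, rfl⟩
  simp

/-- Supplies the necklace that bounds the successor of y01^r from above in `IsUpper.next`. -/
theorem IsPre.isNeck_increment {y : List Bool} {c : List Bool} (h : IsPre (y ++ false :: c))
    (r : ℕ) : IsNeck (y ++ true :: List.replicate r true) := by
  cases y with
  | nil => exact isNeck_replicate (r + 1) true
  | cons b t =>
    obtain rfl := h.head_false b t rfl
    have := (IsLyn.append_true r (y := t ++ [true]) h.isLyn_append_true).isNeck
    simpa using this

/-- A suffix starting strictly inside the first copy of Z is decided by the Lyndon property; one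
starting later is a suffix of a shorter extension of Z. -/
theorem isPre_ext {Z : List Bool} (h : IsLyn Z) (n : ℕ) : IsPre (ext n Z) := by
  induction n using Nat.strong_induction_on with
  | _ n ih =>
  rcases le_total n Z.length with hn | hn
  · rw [ext_of_le h.1 hn]
    exact h.isPre.of_prefix (List.take_prefix _ _)
  obtain ⟨m, rfl⟩ := Nat.exists_eq_add_of_le hn
  have hpos := List.length_pos_iff.2 h.1
  intro a b hab
  have hU := ext_prefix_ext h.1 (Nat.le_add_left m Z.length)
  rw [ext_add h.1, List.append_eq_append_iff] at hab
  rcases hab with ⟨c, hc, rfl⟩ | ⟨c, rfl, hc⟩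
  · rcases eq_or_ne a [] with rfl | ha
    · simp only [List.nil_append] at hc; subst hc
      rw [ext_add h.1, List.take_of_length_le le_rfl]
    rcases eq_or_ne c [] with rfl | hc0
    · obtain ⟨t, ht⟩ := hU
      rw [← ht]; simp
    · refine le_of_lt (lt_of_take_lt_take (k := c.length) ?_)
      rw [List.take_left, List.take_take, List.length_append, min_eq_left (by omega), ext_add h.1,
        List.take_append_of_le_length (by rw [hc]; simp)]
      exact h.2 a c hc.symm ha hc0
  · have h1 := ih m (by omega) c b hc.symm
    have hl : b.length ≤ (ext m Z).length := by rw [hc]; simp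
    obtain ⟨t, ht⟩ := hU
    rwa [← ht, List.take_append_of_le_length hl]

/-- If V = ZV₂, then V₂ is at least the prefix of V of length |V₂|. That prefix is a shorter
prenecklace comparable with Z, so by induction it is at least the extension of Z of that length. -/
theorem ext_le_of_isPre {Z V : List Bool} (hZ : Z ≠ []) (hV : IsPre V)
    (h : Z <+: V ∨ V <+: Z) : ext V.length Z ≤ V := by
  induction hn : V.length using Nat.strong_induction_on generalizing V with
  | _ n ih =>
  subst hn
  rcases h with ⟨V₂, rfl⟩ | h
  · rw [List.length_append, ext_add hZ, append_le_append_iff]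
    have hpos := List.length_pos_iff.2 hZ
    have hp : IsPre ((Z ++ V₂).take V₂.length) := hV.of_prefix (List.take_prefix _ _)
    have hl : ((Z ++ V₂).take V₂.length).length = V₂.length := by simp
    have h1 := ih V₂.length (by simp; omega) hp (List.prefix_or_prefix_of_prefix
      (List.prefix_append Z V₂) (List.take_prefix V₂.length (Z ++ V₂))) hl
    exact h1.trans (hV Z V₂ rfl)
  · obtain ⟨t, rfl⟩ := h
    rw [ext_of_le hZ (by simp), List.take_left]

/-! ### Rotations of powers of a Lyndon word -/

theorem rotate_pow_length (Z : List Bool) (k : ℕ) : (pow Z k).rotate Z.length = pow Z k := by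
  cases k with
  | zero => simp [pow]
  | succ k => rw [pow_succ, List.rotate_append_length_eq, ← pow_succ', pow_succ]

theorem rotate_pow_mod (Z : List Bool) (k i : ℕ) :
    (pow Z k).rotate i = (pow Z k).rotate (i % Z.length) := by
  have h : ∀ q, (pow Z k).rotate (Z.length * q) = pow Z k := by
    intro q
    induction q with
    | zero => simp
    | succ q ih => rw [Nat.mul_succ, ← List.rotate_rotate, ih, rotate_pow_length]
  conv_lhs => rw [← Nat.div_add_mod i Z.length, ← List.rotate_rotate, h]

theorem rotate_pow_succ {Z : List Bool} {i : ℕ} (k : ℕ) (hi : i ≤ Z.length) :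
    (pow Z (k + 1)).rotate i = Z.drop i ++ (pow Z k ++ Z.take i) := by
  rw [List.rotate_eq_drop_append_take (by rw [length_pow, Nat.add_mul]; omega), pow_succ,
    List.drop_append_of_le_length hi, List.take_append_of_le_length hi, List.append_assoc]

theorem IsLyn.pow_lt_rotate {Z : List Bool} (h : IsLyn Z) (k : ℕ) {i : ℕ} (h0 : 0 < i)
    (hi : i < Z.length) : pow Z (k + 1) < (pow Z (k + 1)).rotate i := by
  rw [rotate_pow_succ k hi.le, pow_succ]
  exact h.lt_rotate (List.take_append_drop i Z) (by simp; exact ⟨by omega, h.1⟩)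
    (by simpa using hi) _ _

theorem IsLyn.isNeck_pow {Z : List Bool} (h : IsLyn Z) (k : ℕ) : IsNeck (pow Z k) := by
  cases k with
  | zero => exact isNeck_replicate 0 true
  | succ k =>
    rintro v ⟨i, rfl⟩
    rw [rotate_pow_mod]
    rcases Nat.eq_zero_or_pos (i % Z.length) with h0 | h0
    · simp [h0]
    · exact (h.pow_lt_rotate k h0 (Nat.mod_lt _ (List.length_pos_iff.2 h.1))).le

theorem IsLyn.rotate_pow_injOn {Z : List Bool} (h : IsLyn Z) (k : ℕ) {i j : ℕ}
    (hi : i < Z.length) (hj : j < Z.length)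
    (hij : (pow Z (k + 1)).rotate i = (pow Z (k + 1)).rotate j) : i = j := by
  wlog hlt : i < j generalizing i j
  · rcases lt_trichotomy i j with h' | h' | h'
    · exact this hi hj hij h'
    · exact h'
    · exact (this hj hi hij.symm h').symm
  exfalso
  obtain ⟨m, rfl⟩ := Nat.exists_eq_add_of_le hlt.le
  have : pow Z (k + 1) = (pow Z (k + 1)).rotate m := by
    apply List.rotate_injective i
    simp only [hij, List.rotate_rotate, add_comm]
  exact absurd this (h.pow_lt_rotate k (by omega) (by omega)).ne

theorem IsLyn.ncard_necklace {Z : List Bool} (h : IsLyn Z) (k : ℕ) :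
    (necklace (pow Z (k + 1))).ncard = Z.length := by
  have : necklace (pow Z (k + 1)) =
      ((Finset.range Z.length).image fun i => (pow Z (k + 1)).rotate i : Finset (List Bool)) := by
    ext v
    simp only [necklace, Set.mem_ofPred_eq, Finset.coe_image, Finset.coe_range, Set.mem_image,
      Set.mem_Iio]
    constructor
    · rintro ⟨i, rfl⟩
      exact ⟨i % Z.length, Nat.mod_lt _ (List.length_pos_iff.2 h.1), (rotate_pow_mod _ _ _).symm⟩
    · rintro ⟨i, -, rfl⟩
      exact ⟨i, rfl⟩
  rw [this, Set.ncard_coe_finset, Finset.card_image_of_injOn, Finset.card_range]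
  intro i hi j hj hij
  exact h.rotate_pow_injOn k (by simpa using hi) (by simpa using hj) hij

/-- Write the word as Z^{q+1}P with P a proper nonempty prefix of Z, Z = PS. Moving P to the front
gives a smaller rotation: after cancelling P, it continues with Z where the original continues with
the larger S. -/
theorem IsLyn.not_isNeck_ext {Z : List Bool} (h : IsLyn Z) {n : ℕ} (hn : Z.length ≤ n)
    (hd : ¬ Z.length ∣ n) : ¬ IsNeck (ext n Z) := by
  intro hN
  have hpos := List.length_pos_iff.2 h.1
  have hr := Nat.mod_lt n hpos
  have hr0 : 0 < n % Z.length := Nat.pos_of_ne_zero fun h0 => hd (Nat.dvd_of_mod_eq_zero h0)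
  have hext : ext n Z = pow Z (n / Z.length) ++ Z.take (n % Z.length) := by
    have := Nat.div_add_mod n Z.length
    rw [ext_eq h.1 (k := n / Z.length + 1) (by rw [Nat.add_mul, mul_comm]; omega), pow_succ',
      List.take_append, List.take_of_length_le (by rw [length_pow, mul_comm]; omega), length_pow]
    congr 2
    rw [mul_comm]; omega
  obtain ⟨q, hq⟩ : ∃ q, n / Z.length = q + 1 :=
    ⟨n / Z.length - 1, by have := Nat.div_pos hn hpos; omega⟩
  rw [hq] at hext
  have hle := hN (Z.take (n % Z.length) ++ pow Z (q + 1)) (by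
    rw [hext]; exact List.isRotated_append)
  rw [hext, pow_succ] at hle
  have key := h.lt_rotate (List.take_append_drop (n % Z.length) Z)
    (by simp; exact ⟨by omega, h.1⟩) (by simpa using hr) (pow Z q)
    (pow Z q ++ Z.take (n % Z.length))
  rw [← append_lt_append_iff (Z.take (n % Z.length)), ← List.append_assoc, ← List.append_assoc,
    List.take_append_drop] at key
  rw [← List.append_assoc] at key
  exact absurd key (not_lt.2 (by simpa using hle))

/-! ### The algorithm -/

theorem lastZero_eq (y : List Bool) (r : ℕ) :
    lastZero (y ++ false :: List.replicate r true) = y.length + 1 := by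
  refine le_antisymm (Finset.sup_le ?_) ?_
  · intro t ht
    simp only [Finset.mem_filter, Finset.mem_Icc] at ht
    obtain ⟨⟨h1, -⟩, h2⟩ := ht
    by_contra hlt
    simp only [id, not_le] at hlt
    obtain ⟨m, rfl⟩ : ∃ m, t = y.length + 2 + m := ⟨t - (y.length + 2), by omega⟩
    rw [List.getElem?_append_right (by omega)] at h2
    have : y.length + 2 + m - 1 - y.length = m + 1 := by omega
    rw [this, List.getElem?_cons_succ] at h2
    exact absurd (List.eq_of_mem_replicate (List.mem_of_getElem? h2)) (by decide)
  · refine Finset.le_sup (f := id) ?_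
    simp

theorem loopBody_eq (n : ℕ) (y : List Bool) (r : ℕ) (L : List (List Bool)) :
    loopBody n (y ++ false :: List.replicate r true, L) =
      (ext n (y ++ [true]),
        if (y ++ [true]).length ∣ n then L ++ [y ++ [true]] else L) := by
  simp [loopBody, lastZero_eq, ext]

theorem IsLyn.ext_isNeck {Z : List Bool} (h : IsLyn Z) {n : ℕ} (hd : Z.length ∣ n) :
    IsNeck (ext n Z) := by
  obtain ⟨k, rfl⟩ := hd
  rw [mul_comm, ext_mul h.1]
  exact h.isNeck_pow k

/-- Among the words of its length that start with y0, the word y01^r is the largest. -/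
theorem increment_le {y V : List Bool} {r : ℕ} (hl : V.length = y.length + 1 + r)
    (h : y ++ false :: List.replicate r true < V) :
    (y ++ [true]) <+: V ∨ y ++ [true] < V.take (y.length + 1) := by
  have h1 := take_le_take_of_le h.le (y.length + 1)
  have h2 : (y ++ false :: List.replicate r true).take (y.length + 1) = y ++ [false] := by
    simp [List.take_append]
  rw [h2] at h1
  rcases lt_trichotomy (y ++ [true]) (V.take (y.length + 1)) with h3 | h3 | h3
  · exact Or.inr h3
  · exact Or.inl (h3 ▸ List.take_prefix _ _)
  exfalso
  have hVl : (V.take (y.length + 1)).length = y.length + 1 := by simp; omega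
  have hy : V.take y.length = y := by
    apply le_antisymm
    · have := take_le_take_of_le h3.le y.length
      simpa [List.take_take] using this
    · have := take_le_take_of_le h1 y.length
      simpa [List.take_take] using this
  obtain ⟨e, he⟩ : ∃ e, V = y ++ e := ⟨V.drop y.length, by
    conv_lhs => rw [← List.take_append_drop y.length V, hy]⟩
  subst he
  rw [append_lt_append_iff] at h
  cases e with
  | nil => simp at hl; omega
  | cons c e =>
    simp only [List.length_append, List.length_cons] at hl
    cases c with
    | true =>
      rw [List.append_cons, List.take_append_of_le_length (by simp),
        List.take_of_length_le (by simp)] at h3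
      exact absurd h3 (lt_irrefl _)
    | false =>
      rw [List.cons_lt_cons_iff] at h
      rcases h with h | ⟨-, h⟩
      · exact absurd h (by decide)
      · exact absurd h (not_lt.2 (le_replicate_true e r (by omega)))

theorem ext_le_of_lt {y V : List Bool} {r n : ℕ} (hn : y.length + 1 + r = n)
    (hl : V.length = n) (hV : IsPre V) (h : y ++ false :: List.replicate r true < V) :
    ext n (y ++ [true]) ≤ V := by
  subst hn
  rcases increment_le hl h with h1 | h1
  · have := ext_le_of_isPre (by simp) hV (Or.inl h1)
    rwa [hl] at this
  · refine (lt_of_take_lt_take (k := y.length + 1) ?_).le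
    obtain ⟨t, ht⟩ := prefix_ext (Z := y ++ [true]) (by simp) (n := y.length + 1 + r) (by simp)
    rw [← ht, List.take_append_of_le_length (by simp), List.take_of_length_le (by simp)]
    exact h1

/-- The order on the output compares the whole necklace of a with the root b. As a root is a prefix
of its necklace, this orders both the roots and the necklaces. The induction is on the number of
words of length n above Y. -/
theorem exists_run (n : ℕ) (Y : List Bool) (L : List (List Bool)) (hl : Y.length = n)
    (hY : IsPre Y) :
    ∃ t X, (loopBody n)^[t] (Y, L) = (List.replicate n true, L ++ X) ∧
      (∀ u < t, ((loopBody n)^[u] (Y, L)).1 ≠ List.replicate n true) ∧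
      X.Pairwise (fun a b => ext n a < b) ∧
      (∀ Z ∈ X, IsLyn Z ∧ Z.length ∣ n ∧ Y < Z) ∧
      ∀ w, w.length = n → IsNeck w → Y < w → ∃ Z ∈ X, ext n Z = w := by
  induction hc : {v : List Bool | v.length = n ∧ Y < v}.ncard using Nat.strong_induction_on
    generalizing Y L with
  | _ c ih =>
  by_cases hone : Y = List.replicate n true
  · subst hone
    refine ⟨0, [], by simp, by simp, by simp, by simp, ?_⟩
    intro w hw _ h
    exact absurd h (not_lt.2 (le_replicate_true w n hw.le))
  obtain ⟨y, r, rfl⟩ := exists_last_zero (Y := Y) (by rwa [hl])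
  have hn : y.length + 1 + r = n := by simp at hl; omega
  set Z := y ++ [true] with hZ
  have hZ0 : Z ≠ [] := by simp [hZ]
  have hLyn : IsLyn Z := hY.isLyn_append_true
  have hYZ : y ++ false :: List.replicate r true < Z := append_false_lt_append_true y _ []
  have hZn : Z.length ≤ n := by simp [hZ]; omega
  have hZext : Z ≤ ext n Z := le_of_prefix (prefix_ext hZ0 hZn)
  have hYext := hYZ.trans_le hZext
  obtain ⟨t, X, h1, h2, h3, h4, h5⟩ := ih _ (by
      rw [← hc]
      refine Set.ncard_lt_ncard ⟨fun v hv => ⟨hv.1, hYext.trans hv.2⟩, fun hsub => ?_⟩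
        ((List.finite_length_eq Bool n).subset fun v hv => hv.1)
      exact lt_irrefl _ (hsub (a := ext n Z) ⟨length_ext hZ0 n, hYext⟩).2) (ext n Z)
    (if Z.length ∣ n then L ++ [Z] else L) (length_ext hZ0 n) (isPre_ext hLyn n) rfl
  refine ⟨t + 1, if Z.length ∣ n then Z :: X else X, ?_, ?_, ?_, ?_, ?_⟩
  · rw [Function.iterate_succ_apply, loopBody_eq, h1]
    split_ifs <;> simp
  · intro u hu
    cases u with
    | zero => exact hone
    | succ u =>
      rw [Function.iterate_succ_apply, loopBody_eq]
      exact h2 u (by omega)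
  · split_ifs
    · exact List.pairwise_cons.2 ⟨fun b hb => (h4 b hb).2.2, h3⟩
    · exact h3
  · have h4' : ∀ V ∈ X, IsLyn V ∧ V.length ∣ n ∧ y ++ false :: List.replicate r true < V :=
      fun V hV => ⟨(h4 V hV).1, (h4 V hV).2.1, hYext.trans (h4 V hV).2.2⟩
    split_ifs with hd
    · intro V hV
      rcases List.mem_cons.1 hV with rfl | hV
      · exact ⟨hLyn, hd, hYZ⟩
      · exact h4' V hV
    · exact h4'
  · intro w hw hN hlt
    rcases (ext_le_of_lt hn hw hN.isPre hlt).eq_or_lt with he | he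
    · have hd : Z.length ∣ n := by
        by_contra hd
        exact hLyn.not_isNeck_ext hZn hd (he ▸ hN)
      rw [if_pos hd]
      exact ⟨Z, by simp, he⟩
    · obtain ⟨V, hV, hVw⟩ := h5 w hw hN he
      refine ⟨V, ?_, hVw⟩
      split_ifs <;> simp [hV]

/-! ### Windows of the concatenation of Lyndon words -/

/-- `X` is the increasing list of the roots of an upward closed set of necklaces of order `n`. -/
def IsUpper (n : ℕ) (X : List (List Bool)) : Prop :=
  X.Pairwise (fun a b => ext n a < b) ∧ (∀ Z ∈ X, IsLyn Z ∧ Z.length ∣ n) ∧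
    ∀ Z ∈ X, ∀ w, w.length = n → IsNeck w → ext n Z < w → ∃ Z' ∈ X, ext n Z' = w

theorem exists_ext_eq_pow {Z : List Bool} {n : ℕ} (hZ : Z ≠ []) (hd : Z.length ∣ n)
    (hn : 0 < n) : ∃ k, n = (k + 1) * Z.length ∧ ext n Z = pow Z (k + 1) := by
  obtain ⟨k, rfl⟩ := hd
  cases k with
  | zero => simp at hn
  | succ k => exact ⟨k, mul_comm _ _, by rw [mul_comm, ext_mul hZ]⟩

theorem le_ext {Z : List Bool} {n : ℕ} (hZ : Z ≠ []) (hd : Z.length ∣ n) (hn : 0 < n) :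
    Z ≤ ext n Z :=
  le_of_prefix (prefix_ext hZ (Nat.le_of_dvd hn hd))

theorem exists_last_zero_root {Z : List Bool} {n : ℕ} (hZ : Z ≠ []) (hd : Z.length ∣ n)
    (hn : 0 < n) (h : ext n Z ≠ List.replicate n true) :
    ∃ u r, Z = u ++ false :: List.replicate r true := by
  refine exists_last_zero fun h' => h ?_
  obtain ⟨k, hk, he⟩ := exists_ext_eq_pow hZ hd hn
  rw [he, h', pow, List.flatten_replicate_replicate, ← hk]

theorem pow_succ_last_zero (u : List Bool) (r k : ℕ) :
    pow (u ++ false :: List.replicate r true) (k + 1) =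
      (pow (u ++ false :: List.replicate r true) k ++ u) ++ false :: List.replicate r true := by
  rw [pow_succ', List.append_assoc]

theorem IsUpper.tail {n : ℕ} (hn : 0 < n) {Z : List Bool} {X : List (List Bool)}
    (h : IsUpper n (Z :: X)) : IsUpper n X := by
  obtain ⟨h1, h2, h3⟩ := h
  rw [List.pairwise_cons] at h1
  refine ⟨h1.2, fun V hV => h2 V (by simp [hV]), fun V hV w hw hN hlt => ?_⟩
  obtain ⟨V', hV', rfl⟩ := h3 V (by simp [hV]) w hw hN hlt
  rcases List.mem_cons.1 hV' with rfl | hV'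
  · have hp := h2 V (by simp [hV])
    exact absurd ((h1.1 V hV).trans_le (le_ext hp.1.1 hp.2 hn)) hlt.not_gt
  · exact ⟨V', hV', rfl⟩

theorem IsUpper.of_append {n : ℕ} (hn : 0 < n) {A X : List (List Bool)}
    (h : IsUpper n (A ++ X)) : IsUpper n X := by
  induction A with
  | nil => exact h
  | cons a A ih => exact ih (IsUpper.tail hn h)

theorem IsUpper.ext_lt {n : ℕ} (hn : 0 < n) {Z V : List Bool} {X : List (List Bool)}
    (h : IsUpper n (Z :: X)) (hV : V ∈ X) : ext n Z < ext n V := by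
  have hp := h.2.1 V (by simp [hV])
  exact ((List.pairwise_cons.1 h.1).1 V hV).trans_le (le_ext hp.1.1 hp.2 hn)

/-- The next necklace lies above y01^r and is at most the necklace y11^r, which forces the prefix
y1. -/
theorem IsUpper.next {n : ℕ} (hn : 0 < n) {Z y : List Bool} {X : List (List Bool)} {r : ℕ}
    (h : IsUpper n (Z :: X)) (hw : ext n Z = y ++ false :: List.replicate r true) :
    ∃ V X', X = V :: X' ∧ (y ++ [true]) <+: ext n V := by
  have hZ := h.2.1 Z (by simp)
  have hlen : n = y.length + 1 + r := by
    rw [← length_ext hZ.1.1 n, hw]; simp; omega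
  have hp : IsPre (y ++ false :: List.replicate r true) := hw ▸ isPre_ext hZ.1 n
  have hlt : ext n Z < y ++ true :: List.replicate r true := by
    rw [hw]; exact append_false_lt_append_true _ _ _
  obtain ⟨V', hV', hVe⟩ := h.2.2 Z (by simp) (y ++ true :: List.replicate r true)
    (by simp; omega) (hp.isNeck_increment r) hlt
  have hV'X : V' ∈ X := by
    rcases List.mem_cons.1 hV' with rfl | hV'
    · exact absurd hVe hlt.ne
    · exact hV'
  cases X with
  | nil => simp at hV'X
  | cons V X' =>
    refine ⟨V, X', rfl, ?_⟩
    have hV := h.2.1 V (by simp)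
    have hle : ext n V ≤ y ++ true :: List.replicate r true := by
      rw [← hVe]
      rcases List.mem_cons.1 hV'X with rfl | hV''
      · exact le_rfl
      · exact ((IsUpper.tail hn h).ext_lt hn hV'').le
    have hgt := h.ext_lt hn (V := V) (by simp)
    rw [hw] at hgt
    rcases increment_le (by rw [length_ext hV.1.1]; exact hlen) hgt with h1 | h1
    · exact h1
    · have := take_le_take_of_le hle (y.length + 1)
      rw [List.append_cons, List.take_append_of_le_length (l₁ := y ++ [true]) (by simp),
        List.take_of_length_le (l := y ++ [true]) (by simp)] at this
      exact absurd h1 (not_lt.2 this)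

theorem prefix_pow_append {Z y t : List Bool} {r k : ℕ}
    (hw : pow Z (k + 1) = y ++ false :: List.replicate r true)
    (hZ : ∃ u r', Z = u ++ false :: List.replicate r' true) (hy : y <+: t) :
    pow Z (k + 1) <+: Z ++ t := by
  obtain ⟨u, r', hZ⟩ := hZ
  have : y = pow Z k ++ u := by
    rw [hZ, pow_succ_last_zero] at hw
    rw [hZ]
    exact (last_zero_unique hw).1.symm
  subst this
  rw [pow_succ, List.prefix_append_right_inj]
  exact (List.prefix_append _ _).trans hy

/-- The next necklace starts with y1 and, by induction along the list, is itself a prefix of the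
concatenation from its root on. -/
theorem IsUpper.prefix_flatten_tail {n : ℕ} (hn : 0 < n) {Z y : List Bool}
    {X : List (List Bool)} {r : ℕ} (h : IsUpper n (Z :: X))
    (hw : ext n Z = y ++ false :: List.replicate r true) : y <+: X.flatten := by
  induction X generalizing Z y r with
  | nil =>
    obtain ⟨V, X', hX, -⟩ := h.next hn hw
    simp at hX
  | cons V X ih =>
    obtain ⟨V', X', hX, hpre⟩ := h.next hn hw
    obtain ⟨rfl, rfl⟩ := List.cons.inj hX
    have hV := h.2.1 V (by simp)
    have hZ := h.2.1 Z (by simp)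
    by_cases hone : ext n V = List.replicate n true
    -- A nonempty y starts with 0, so it cannot be a prefix of 1^n.
    · cases y with
      | nil => exact List.nil_prefix
      | cons b t =>
        have hb := (hw ▸ isPre_ext hZ.1 n : IsPre (b :: t ++ _)).head_false b t rfl
        rw [hone] at hpre
        have : b ∈ List.replicate n true := hpre.subset (by simp)
        rw [List.eq_of_mem_replicate this] at hb
        exact absurd hb (by decide)
    · have hroot := exists_last_zero_root hV.1.1 hV.2 hn hone
      obtain ⟨y', r', hw'⟩ := exists_last_zero (Y := ext n V) (by rwa [length_ext hV.1.1])
      obtain ⟨k, hk, he⟩ := exists_ext_eq_pow hV.1.1 hV.2 hn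
      have := prefix_pow_append (he ▸ hw') hroot (ih (IsUpper.tail hn h) hw')
      rw [← he] at this
      exact ((List.prefix_append y [true]).trans hpre).trans this

theorem IsUpper.ext_prefix_flatten {n : ℕ} (hn : 0 < n) {Z : List Bool}
    {X : List (List Bool)} (h : IsUpper n (Z :: X)) (hone : ext n Z ≠ List.replicate n true) :
    ext n Z <+: (Z :: X).flatten := by
  have hZ := h.2.1 Z (by simp)
  obtain ⟨y, r, hw⟩ := exists_last_zero (Y := ext n Z) (by rwa [length_ext hZ.1.1])
  obtain ⟨k, hk, he⟩ := exists_ext_eq_pow hZ.1.1 hZ.2 hn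
  rw [he]
  exact prefix_pow_append (he ▸ hw) (exists_last_zero_root hZ.1.1 hZ.2 hn hone)
    (h.prefix_flatten_tail hn hw)

/-- With Z = u01^r and necklace Z^{k+1}, the concatenation from Z on starts with ZZ^ku, which
contains the rotation by any i ≤ |u|. -/
theorem IsUpper.rotate_infix_flatten {n : ℕ} (hn : 0 < n) {u : List Bool} {r i : ℕ}
    {X : List (List Bool)} (h : IsUpper n ((u ++ false :: List.replicate r true) :: X))
    (hi : i ≤ u.length) :
    (ext n (u ++ false :: List.replicate r true)).rotate i <:+:
      ((u ++ false :: List.replicate r true) :: X).flatten := by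
  set Z := u ++ false :: List.replicate r true with hZdef
  have hZ := h.2.1 Z (by simp)
  obtain ⟨k, hk, he⟩ := exists_ext_eq_pow hZ.1.1 hZ.2 hn
  have hw : ext n Z = (pow Z k ++ u) ++ false :: List.replicate r true := by
    rw [he, hZdef, pow_succ_last_zero]
  obtain ⟨c, hc⟩ := h.prefix_flatten_tail hn hw
  rw [he, rotate_pow_succ k (by rw [hZdef]; simp; omega), List.flatten_cons, ← hc]
  refine ⟨Z.take i, u.drop i ++ c, ?_⟩
  have h1 : Z.take i = u.take i := by rw [hZdef, List.take_append_of_le_length hi]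
  calc Z.take i ++ (Z.drop i ++ (pow Z k ++ Z.take i)) ++ (u.drop i ++ c)
      = (Z.take i ++ Z.drop i) ++ (pow Z k ++ (Z.take i ++ u.drop i) ++ c) := by
        simp only [List.append_assoc]
    _ = Z ++ (pow Z k ++ u ++ c) := by
        rw [List.take_append_drop, h1, List.take_append_drop]

theorem exists_first {α : Type*} {P : α → Prop} {l : List α} (h : ∃ x ∈ l, P x) :
    ∃ A v B, l = A ++ v :: B ∧ P v ∧ ∀ a ∈ A, ¬ P a := by
  induction l with
  | nil => simp at h
  | cons a l ih =>
    by_cases ha : P a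
    · exact ⟨[], a, l, rfl, ha, by simp⟩
    · obtain ⟨A, v, B, rfl, hv, hA⟩ := ih (by
        obtain ⟨x, hx, hP⟩ := h
        rcases List.mem_cons.1 hx with rfl | hx
        · exact absurd hP ha
        · exact ⟨x, hx, hP⟩)
      exact ⟨a :: A, v, B, rfl, hv, by simpa [ha] using hA⟩

/-- The largest necklace below 1^n is 01^{n-1}, which is its own root. The list therefore ends with
the roots 01^{n-1} and 1. -/
theorem IsUpper.ones_suffix_flatten {n : ℕ} (hn : 0 < n) {Z : List Bool}
    {X : List (List Bool)} (h : IsUpper n X) (hZX : Z ∈ X)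
    (hone : ext n Z ≠ List.replicate n true) : List.replicate n true <:+ X.flatten := by
  obtain ⟨m, rfl⟩ : ∃ m, n = m + 1 := ⟨n - 1, by omega⟩
  have hZ := h.2.1 Z hZX
  have hle : ext (m + 1) Z ≤ false :: List.replicate m true := by
    obtain ⟨y, r, hw⟩ := exists_last_zero (Y := ext (m + 1) Z) (by rwa [length_ext hZ.1.1])
    have hlen := length_ext hZ.1.1 (m + 1)
    have hp := isPre_ext hZ.1 (m + 1)
    obtain ⟨t, ht⟩ : ∃ t, ext (m + 1) Z = false :: t := by
      rw [hw] at hp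
      cases y with
      | nil => exact ⟨_, hw⟩
      | cons b t =>
        obtain rfl := hp.head_false b t rfl
        exact ⟨_, hw⟩
    rw [ht] at hlen ⊢
    rw [cons_le_cons_iff]
    exact Or.inr ⟨rfl, le_replicate_true t m (by simpa using hlen.le)⟩
  have hN : IsNeck (false :: List.replicate m true) :=
    (IsLyn.append_true m (y := []) ⟨by simp, by
      intro a b hab ha hb
      rw [List.append_eq_singleton_iff] at hab
      rcases hab with ⟨rfl, -⟩ | ⟨-, rfl⟩
      · exact absurd rfl ha
      · exact absurd rfl hb⟩).isNeck
  obtain ⟨V, hV, hVe⟩ : ∃ V ∈ X, ext (m + 1) V = [] ++ false :: List.replicate m true := by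
    rcases hle.eq_or_lt with he | he
    · exact ⟨Z, hZX, he⟩
    · exact h.2.2 Z hZX _ (by simp) hN he
  obtain ⟨A, B, rfl⟩ := List.append_of_mem hV
  have hVB := IsUpper.of_append hn h
  obtain ⟨V', B', rfl, hpre⟩ := hVB.next hn hVe
  have hVL := h.2.1 V hV
  have hV' := hVB.2.1 V' (by simp)
  have hVone : ext (m + 1) V ≠ List.replicate (m + 1) true := by
    rw [hVe, List.replicate_succ]; simp
  obtain ⟨u, r, rfl⟩ := exists_last_zero_root hVL.1.1 hVL.2 hn hVone
  obtain ⟨k, hk, he⟩ := exists_ext_eq_pow hVL.1.1 hVL.2 hn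
  rw [he, pow_succ_last_zero] at hVe
  obtain ⟨h1, hr⟩ := last_zero_unique hVe
  replace hr := hr.symm
  subst hr
  obtain ⟨-, rfl⟩ := List.append_eq_nil_iff.1 h1
  have hV'one : ext (m + 1) V' = List.replicate (m + 1) true := by
    by_contra hne
    obtain ⟨y, r', hw⟩ := exists_last_zero (Y := ext (m + 1) V') (by rwa [length_ext hV'.1.1])
    have hp := isPre_ext hV'.1 (m + 1)
    rw [hw] at hp hpre
    cases y with
    | nil => simp at hpre
    | cons b t =>
      obtain rfl := hp.head_false b t rfl
      simp at hpre
  have hV'1 : V' = [true] := by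
    have hsub : ∀ x ∈ V', x = true := fun x hx => List.eq_of_mem_replicate
      (hV'one ▸ (prefix_ext hV'.1.1 (Nat.le_of_dvd hn hV'.2)).subset hx)
    have hrep := List.eq_replicate_of_mem hsub
    match hl : V'.length with
    | 0 => exact absurd (List.length_eq_zero_iff.1 hl) hV'.1.1
    | 1 => rw [hl] at hrep; simpa using hrep
    | q + 2 =>
      rw [hl] at hrep
      have := hV'.1.2 [true] (List.replicate (q + 1) true)
        (by rw [hrep]; simp [List.replicate_succ]) (by simp) (by simp)
      rw [hrep] at this
      simp [List.take_replicate] at this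
  have hB' : B' = [] := by
    rcases B' with - | ⟨V'', B''⟩
    · rfl
    · have hlt := (IsUpper.tail hn hVB).ext_lt hn (V := V'') (by simp)
      rw [hV'one] at hlt
      exact absurd hlt (not_lt.2 (le_replicate_true _ _
        (length_ext (hVB.2.1 V'' (by simp)).1.1 _).le))
  subst hV'1 hB'
  refine ⟨A.flatten ++ [false], ?_⟩
  simp [List.replicate_succ']

/-! ### Recognising cyclic windows, and finding every rotation among them -/

theorem cyclicWindow_eq_of_prefix {n i : ℕ} {v l : List Bool} (h : v <+: (l ++ l).drop i)
    (hv : v.length = n) (hi : i < l.length) : cyclicWindow n l i = v := by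
  subst hv
  have hlen := h.length_le
  simp only [List.length_drop, List.length_append] at hlen
  refine List.ext_getElem (by simp [cyclicWindow]) fun j h1 h2 => ?_
  simp only [cyclicWindow, List.getElem_ofFn]
  rw [h.getElem h2, List.getElem_drop]
  have hmod : (i + j) % l.length < l.length := Nat.mod_lt _ (by omega)
  rw [List.getD_eq_getElem _ _ hmod]
  by_cases hj : i + j < l.length
  · rw [List.getElem_append_left hj]
    simp only [Nat.mod_eq_of_lt hj]
  · rw [List.getElem_append_right (by omega)]
    congr 1
    rw [Nat.mod_eq_sub_mod (by omega), Nat.mod_eq_of_lt (by omega)]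

theorem exists_cyclicWindow_of_infix {n : ℕ} (hn : 0 < n) {v l : List Bool} (h : v <:+: l)
    (hv : v.length = n) : ∃ i < l.length, cyclicWindow n l i = v := by
  obtain ⟨a, b, rfl⟩ := h
  have hi : a.length < (a ++ v ++ b).length := by simp; omega
  refine ⟨a.length, hi, cyclicWindow_eq_of_prefix ⟨b ++ (a ++ v ++ b), ?_⟩ hv hi⟩
  simp

theorem exists_cyclicWindow_of_suffix_prefix {n : ℕ} {a p l : List Bool} (ha : a <:+ l)
    (hp : p <+: l) (ha0 : a ≠ []) (hv : (a ++ p).length = n) :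
    ∃ i < l.length, cyclicWindow n l i = a ++ p := by
  obtain ⟨c, hc⟩ := ha
  obtain ⟨d, hd⟩ := hp
  have hi : c.length < l.length := by
    have := List.length_pos_iff.2 ha0
    rw [← hc]; simp; omega
  refine ⟨c.length, hi, cyclicWindow_eq_of_prefix ⟨d, ?_⟩ hv hi⟩
  have : l ++ l = c ++ (a ++ l) := by rw [← List.append_assoc, hc]
  rw [this, List.drop_left, List.append_assoc, hd]

theorem cyclicWindow_of_all_true {n i : ℕ} {l : List Bool} (hl : l ≠ [])
    (h : ∀ x ∈ l, x = true) : cyclicWindow n l i = List.replicate n true := by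
  have hpos := List.length_pos_iff.2 hl
  refine List.ext_getElem (by simp [cyclicWindow]) fun j h1 h2 => ?_
  simp only [cyclicWindow, List.getElem_ofFn, List.getElem_replicate]
  rw [List.getD_eq_getElem _ _ (Nat.mod_lt _ hpos)]
  exact h _ (List.getElem_mem _)

theorem IsUpper.all_true_or_ones_suffix {n : ℕ} (hn : 0 < n) {X : List (List Bool)}
    (h : IsUpper n X) :
    (∀ x ∈ X.flatten, x = true) ∨ List.replicate n true <:+ X.flatten := by
  by_cases hall : ∃ V ∈ X, ext n V ≠ List.replicate n true
  · obtain ⟨V, hV, hne⟩ := hall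
    exact Or.inr (h.ones_suffix_flatten hn hV hne)
  · push Not at hall
    refine Or.inl fun x hx => ?_
    obtain ⟨V, hV, hxV⟩ := List.mem_flatten.1 hx
    have hVL := h.2.1 V hV
    exact List.eq_of_mem_replicate (hall V hV ▸
      (prefix_ext hVL.1.1 (Nat.le_of_dvd hn hVL.2)).subset hxV)

theorem IsUpper.exists_cyclicWindow {n : ℕ} (hn : 0 < n) {Z : List Bool}
    {X : List (List Bool)} (h : IsUpper n X) (hZX : Z ∈ X) {i : ℕ} (hi : i < Z.length) :
    ∃ p < X.flatten.length, cyclicWindow n X.flatten p = (ext n Z).rotate i := by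
  have hZ := h.2.1 Z hZX
  have hrl : ((ext n Z).rotate i).length = n := by rw [List.length_rotate, length_ext hZ.1.1]
  have hpos : 0 < X.flatten.length :=
    (List.length_pos_iff.2 hZ.1.1).trans_le (List.sublist_flatten_of_mem hZX).length_le
  by_cases hone : ext n Z = List.replicate n true
  · rw [hone, List.rotate_replicate]
    rcases h.all_true_or_ones_suffix hn with hall | hsuf
    · exact ⟨0, hpos, cyclicWindow_of_all_true (List.length_pos_iff.1 hpos) hall⟩
    · exact exists_cyclicWindow_of_infix hn hsuf.isInfix (by simp)
  obtain ⟨u, r, rfl⟩ := exists_last_zero_root hZ.1.1 hZ.2 hn hone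
  by_cases hiu : i ≤ u.length
  · obtain ⟨A, B, rfl⟩ := List.append_of_mem hZX
    refine exists_cyclicWindow_of_infix hn ?_ hrl
    refine ((IsUpper.of_append hn h).rotate_infix_flatten hn hiu).trans ?_
    rw [List.flatten_append]
    exact (List.suffix_append _ _).isInfix
  -- The rotation starts within the final run of ones of the root.
  obtain ⟨k, hk, he⟩ := exists_ext_eq_pow hZ.1.1 hZ.2 hn
  obtain ⟨j, rfl⟩ : ∃ j, i = u.length + 1 + j := ⟨i - (u.length + 1), by omega⟩
  obtain ⟨t, rfl⟩ : ∃ t, r = j + t := ⟨r - j, by simp at hi; omega⟩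
  have ht : 0 < t := by simp at hi; omega
  set Z := u ++ false :: List.replicate (j + t) true with hZdef
  have hZt : Z = (u ++ false :: List.replicate j true) ++ List.replicate t true := by
    rw [hZdef, ← List.replicate_append_replicate]; simp
  have hu : (u ++ false :: List.replicate j true).length = u.length + 1 + j := by simp; omega
  set p := pow Z k ++ (u ++ false :: List.replicate j true) with hp
  have hrot : (ext n Z).rotate (u.length + 1 + j) = List.replicate t true ++ p := by
    rw [he, rotate_pow_succ k hi.le, hp, ← hu]
    conv_lhs => rw [hZt]
    rw [List.drop_left, List.take_left, ← hZt]
  have hpZ : ext n Z = p ++ List.replicate t true := by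
    rw [he, pow_succ', hp, List.append_assoc, ← hZt]
  have hpl : p.length + t = n := by rw [← length_ext hZ.1.1 n, hpZ]; simp
  have hpone : ∀ V, p <+: ext n V → ext n V ≠ List.replicate n true := by
    intro V hV h1
    have : false ∈ List.replicate n true := h1 ▸ hV.subset (by simp [hp])
    exact absurd (List.eq_of_mem_replicate this) (by decide)
  rw [hrot] at hrl ⊢
  -- The rotation is 1^t p. It is found across the boundary just before the first root V whose
  -- necklace starts with p.
  obtain ⟨A, V, B, rfl, hV, hA⟩ := exists_first (P := fun V => p <+: ext n V) (l := X)
    ⟨Z, hZX, hpZ ▸ List.prefix_append _ _⟩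
  have hpB : p <+: (V :: B).flatten :=
    hV.trans ((IsUpper.of_append hn h).ext_prefix_flatten hn (hpone V hV))
  -- If V heads the list, the window wraps around and its t ones come from the final 1^n.
  rcases List.eq_nil_or_concat A with rfl | ⟨A, V₀, rfl⟩
  · refine exists_cyclicWindow_of_suffix_prefix ?_ hpB (by simp; omega) hrl
    refine List.IsSuffix.trans ?_ (h.ones_suffix_flatten hn hZX hone)
    exact ⟨List.replicate (n - t) true, by
      rw [List.replicate_append_replicate]; congr 1; omega⟩
  · rw [List.concat_eq_append, List.append_assoc, List.singleton_append] at h ⊢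
    refine exists_cyclicWindow_of_infix hn ?_ hrl
    have hV₀ := IsUpper.of_append hn h
    have hV₀L := hV₀.2.1 V₀ (by simp)
    have hVL := hV₀.2.1 V (by simp)
    have hlt := hV₀.ext_lt hn (V := V) (by simp)
    have hV₀one : ext n V₀ ≠ List.replicate n true := by
      intro h1
      rw [h1] at hlt
      exact absurd hlt (not_lt.2 (le_replicate_true _ _ (length_ext hVL.1.1 n).le))
    obtain ⟨u₀, r₀, rfl⟩ := exists_last_zero_root hV₀L.1.1 hV₀L.2 hn hV₀one
    obtain ⟨k₀, hk₀, he₀⟩ := exists_ext_eq_pow hV₀L.1.1 hV₀L.2 hn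
    rw [pow_succ_last_zero] at he₀
    obtain ⟨V', B', hVB, hpre⟩ := hV₀.next hn he₀
    obtain ⟨rfl, rfl⟩ := List.cons.inj hVB
    have hl₀ := length_ext hV₀L.1.1 n
    rw [he₀] at hl₀
    -- With fewer than t final ones, the predecessor's necklace would share with that of V a prefix
    -- of length at least |p|, hence start with p, against the choice of V.
    have htr : t ≤ r₀ := by
      by_contra hlt'
      refine hA (u₀ ++ false :: List.replicate r₀ true) (by simp) ?_
      rw [he₀]
      refine (List.prefix_of_prefix_length_le hV ((List.prefix_append _ _).trans hpre) ?_).trans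
        (List.prefix_append _ _)
      simp only [List.length_append, List.length_cons, List.length_replicate] at hl₀ ⊢
      omega
    obtain ⟨c, hc⟩ := hpB
    refine ⟨A.flatten ++ (u₀ ++ false :: List.replicate (r₀ - t) true), c, ?_⟩
    have h2 : List.replicate r₀ true = List.replicate (r₀ - t) true ++ List.replicate t true := by
      rw [List.replicate_append_replicate]; congr 1; omega
    rw [List.flatten_append, List.flatten_cons, ← hc, h2]
    simp only [List.append_assoc, List.cons_append]

/-- All the rotations of the necklaces of the roots listed in `X`. -/
def rotations (n : ℕ) (X : List (List Bool)) : List (List Bool) :=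
  X.flatMap fun Z => (List.range Z.length).map fun i => (ext n Z).rotate i

theorem IsUpper.nodup_rotations {n : ℕ} (hn : 0 < n) {X : List (List Bool)}
    (h : IsUpper n X) : (rotations n X).Nodup := by
  rw [rotations, List.nodup_flatMap]
  constructor
  · intro Z hZX
    have hZ := h.2.1 Z hZX
    obtain ⟨k, hk, he⟩ := exists_ext_eq_pow hZ.1.1 hZ.2 hn
    refine List.Nodup.map_on ?_ List.nodup_range
    intro i hi j hj hij
    rw [he] at hij
    exact hZ.1.rotate_pow_injOn k (List.mem_range.1 hi) (List.mem_range.1 hj) hij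
  · refine List.Pairwise.imp_of_mem ?_ h.1
    intro Z V hZX hVX hlt
    have hZ := h.2.1 Z hZX
    have hV := h.2.1 V hVX
    intro v hv hv'
    simp only [List.mem_map, List.mem_range] at hv hv'
    obtain ⟨i, -, hi⟩ := hv
    obtain ⟨j, -, hj⟩ := hv'
    have hr : ext n Z ~r ext n V :=
      (show ext n Z ~r v from ⟨i, hi⟩).trans (show ext n V ~r v from ⟨j, hj⟩).symm
    have h1 := hV.1.ext_isNeck hV.2 _ hr.symm
    exact absurd (hlt.trans_le (le_ext hV.1.1 hV.2 hn)) (not_lt.2 h1)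

theorem length_rotations (n : ℕ) (X : List (List Bool)) :
    (rotations n X).length = X.flatten.length := by
  simp [rotations, List.length_flatMap, List.length_flatten]

/-- Counting replaces a direct proof that windows are distinct: the rotations are distinct, all
occur as windows, and are as numerous as the positions. -/
theorem IsUpper.windows_perm {n : ℕ} (hn : 0 < n) {X : List (List Bool)} (h : IsUpper n X) :
    (rotations n X).Perm
      ((List.range X.flatten.length).map (cyclicWindow n X.flatten)) := by
  refine (List.subperm_of_subset (h.nodup_rotations hn) ?_).perm_of_length_le ?_
  · intro v hv
    simp only [rotations, List.mem_flatMap, List.mem_map, List.mem_range] at hv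
    obtain ⟨Z, hZ, i, hi, rfl⟩ := hv
    obtain ⟨p, hp, hw⟩ := h.exists_cyclicWindow hn hZ hi
    exact List.mem_map.2 ⟨p, List.mem_range.2 hp, hw⟩
  · rw [length_rotations]; simp

theorem IsUpper.cyclicWindow_injOn {n : ℕ} (hn : 0 < n) {X : List (List Bool)}
    (h : IsUpper n X) {i j : ℕ} (hi : i < X.flatten.length) (hj : j < X.flatten.length)
    (hij : cyclicWindow n X.flatten i = cyclicWindow n X.flatten j) : i = j :=
  List.inj_on_of_nodup_map ((h.windows_perm hn).nodup_iff.1 (h.nodup_rotations hn))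
    (List.mem_range.2 hi) (List.mem_range.2 hj) hij

theorem IsUpper.exists_cyclicWindow_iff {n : ℕ} (hn : 0 < n) {X : List (List Bool)}
    (h : IsUpper n X) (v : List Bool) :
    (∃ p < X.flatten.length, cyclicWindow n X.flatten p = v) ↔ ∃ Z ∈ X, ext n Z ~r v := by
  have := (h.windows_perm hn).mem_iff (a := v)
  simp only [List.mem_map, List.mem_range] at this
  rw [← this]
  simp only [rotations, List.mem_flatMap, List.mem_map, List.mem_range]
  refine exists_congr fun Z => and_congr_right fun hZX => ?_
  have hZ := h.2.1 Z hZX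
  obtain ⟨k, hk, he⟩ := exists_ext_eq_pow hZ.1.1 hZ.2 hn
  constructor
  · rintro ⟨i, -, rfl⟩
    exact ⟨i, rfl⟩
  · rintro ⟨i, rfl⟩
    refine ⟨i % Z.length, Nat.mod_lt _ (List.length_pos_iff.2 hZ.1.1), ?_⟩
    rw [he, ← rotate_pow_mod]

/-! ### Words with bounded runs of zeros -/

theorem eq_replicate_false_of_le {v : List Bool} {k : ℕ} (hl : v.length = k)
    (h : v ≤ List.replicate k false) : v = List.replicate k false := by
  induction v generalizing k with
  | nil => subst hl; rfl
  | cons a v ih =>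
    subst hl
    rw [List.length_cons, List.replicate_succ, cons_le_cons_iff] at h
    rcases h with h | ⟨rfl, h⟩
    · exact absurd h (by cases a <;> decide)
    · rw [List.length_cons, List.replicate_succ, ← ih rfl h]

theorem length_initialWord {n s : ℕ} (hs : s < n) : (initialWord n s).length = n := by
  simp [initialWord]; omega

theorem isPre_initialWord (n s : ℕ) : IsPre (initialWord n s) := by
  unfold initialWord
  have hp : ∀ k, IsPre (List.replicate k false) := fun k => (isNeck_replicate k false).isPre
  cases n - s - 1 with
  | zero => simpa using hp (s + 1)
  | succ m =>
    have h1 : IsLyn (List.replicate (s + 1) false ++ [true]) :=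
      IsPre.isLyn_append_true (c := []) (by rw [← List.replicate_succ']; exact hp _)
    have h2 := IsLyn.append_true m (y := List.replicate s false ++ [true])
      (by simpa [List.replicate_succ] using h1)
    simpa [List.replicate_succ] using h2.isPre

theorem le_initialWord_iff {n s : ℕ} (hs : s < n) {v : List Bool} (hv : v.length = n) :
    v ≤ initialWord n s ↔ List.replicate (s + 1) false <+: v := by
  unfold initialWord
  constructor
  · intro h
    have h1 := take_le_take_of_le h (s + 1)
    rw [List.take_left' List.length_replicate] at h1
    rw [← eq_replicate_false_of_le (by rw [List.length_take, hv]; omega) h1]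
    exact List.take_prefix _ _
  · rintro ⟨t, rfl⟩
    rw [append_le_append_iff]
    exact le_replicate_true t _ (by simp at hv; omega)

theorem exists_least_rotation (v : List Bool) : ∃ w, v ~r w ∧ IsNeck w := by
  have hfin : {w | v ~r w}.Finite :=
    (List.finite_length_eq Bool v.length).subset fun w hw => hw.perm.length_eq.symm
  obtain ⟨w, hw, hmin⟩ := Set.exists_min_image _ id hfin ⟨v, List.IsRotated.refl v⟩
  exact ⟨w, hw, fun u hu => hmin u (List.IsRotated.trans hw hu)⟩

/-- `X` lists the roots of the necklaces of order `n` that are greater than the initial word. -/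
def IsRootList (n s : ℕ) (X : List (List Bool)) : Prop :=
  X.Pairwise (fun a b => ext n a < b) ∧
    (∀ Z ∈ X, IsLyn Z ∧ Z.length ∣ n ∧ initialWord n s < Z) ∧
    ∀ w, w.length = n → IsNeck w → initialWord n s < w → ∃ Z ∈ X, ext n Z = w

theorem IsRootList.isUpper {n s : ℕ} (hn : 0 < n) {X : List (List Bool)}
    (h : IsRootList n s X) : IsUpper n X := by
  refine ⟨h.1, fun Z hZ => ⟨(h.2.1 Z hZ).1, (h.2.1 Z hZ).2.1⟩, fun Z hZ w hw hN hlt => ?_⟩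
  obtain ⟨h1, h2, h3⟩ := h.2.1 Z hZ
  exact h.2.2 w hw hN (h3.trans ((le_ext h1.1 h2 hn).trans_lt hlt))

theorem IsRootList.pairwise_lt {n s : ℕ} (hn : 0 < n) {X : List (List Bool)}
    (h : IsRootList n s X) : X.Pairwise (· < ·) := by
  refine List.Pairwise.imp_of_mem ?_ h.1
  intro Z V hZ _ hlt
  exact (le_ext (h.2.1 Z hZ).1.1 (h.2.1 Z hZ).2.1 hn).trans_lt hlt

theorem take_ncard_necklace_ext {n : ℕ} (hn : 0 < n) {Z : List Bool} (h : IsLyn Z)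
    (hd : Z.length ∣ n) : (ext n Z).take (necklace (ext n Z)).ncard = Z := by
  obtain ⟨k, hk, he⟩ := exists_ext_eq_pow h.1 hd hn
  rw [he, h.ncard_necklace, pow_succ, List.take_left]

theorem IsRootList.mem_iff {n s : ℕ} (hn : 0 < n) {X : List (List Bool)}
    (h : IsRootList n s X) (x : List Bool) :
    x ∈ X ↔ IsLyndonWordOfOrder n x ∧ initialWord n s < x := by
  constructor
  · intro hx
    obtain ⟨h1, h2, h3⟩ := h.2.1 x hx
    exact ⟨⟨ext n x, length_ext h1.1 n, h1.ext_isNeck h2,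
      (take_ncard_necklace_ext hn h1 h2).symm⟩, h3⟩
  · rintro ⟨⟨w, hw, hN, rfl⟩, hlt⟩
    obtain ⟨Z, hZ, rfl⟩ := h.2.2 w hw hN (hlt.trans_le (le_of_prefix (List.take_prefix _ _)))
    obtain ⟨h1, h2, -⟩ := h.2.1 Z hZ
    rwa [take_ncard_necklace_ext hn h1 h2]

/-- A necklace is listed iff its least element exceeds the initial word, that is, iff none of its
elements starts with 0^{s+1}. -/
theorem IsRootList.exists_isRotated_iff {n s : ℕ} (hs : s < n) {X : List (List Bool)}
    (h : IsRootList n s X) (v : List Bool) :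
    (∃ Z ∈ X, ext n Z ~r v) ↔
      v.length = n ∧ ∀ u, v ~r u → ¬ List.replicate (s + 1) false <+: u := by
  have hn : 0 < n := by omega
  constructor
  · rintro ⟨Z, hZ, hr⟩
    obtain ⟨h1, h2, h3⟩ := h.2.1 Z hZ
    have hl : v.length = n := by rw [← hr.perm.length_eq, length_ext h1.1]
    refine ⟨hl, fun u hu hp => ?_⟩
    have hul : u.length = n := by rw [← hu.perm.length_eq, hl]
    have h4 := (le_initialWord_iff hs hul).2 hp
    have h5 := h1.ext_isNeck h2 u (hr.trans hu)
    exact absurd (h3.trans_le (le_ext h1.1 h2 hn)) (not_lt.2 (h5.trans h4))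
  · rintro ⟨hl, hv⟩
    obtain ⟨w, hw, hN⟩ := exists_least_rotation v
    have hwl : w.length = n := by rw [← hw.perm.length_eq, hl]
    obtain ⟨Z, hZ, rfl⟩ := h.2.2 w hwl hN
      (lt_of_not_ge fun h' => hv w hw ((le_initialWord_iff hs hwl).1 h'))
    exact ⟨Z, hZ, hw.symm⟩

theorem isNSWord_of_rotations {n s : ℕ} {v : List Bool} (hl : v.length = n)
    (h : ∀ u, v ~r u → ¬ List.replicate (s + 1) false <+: u) : IsNSWord n s v := by
  refine ⟨hl, fun r hr => ?_⟩
  by_contra hlt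
  obtain ⟨a, b, rfl⟩ := hr
  obtain ⟨m, rfl⟩ : ∃ m, r = s + 1 + m := ⟨r - (s + 1), by omega⟩
  refine h (List.replicate (s + 1 + m) false ++ b ++ a) ?_ ?_
  · rw [List.append_assoc]; exact List.isRotated_append
  · rw [List.append_assoc, ← List.replicate_append_replicate (n := s + 1), List.append_assoc]
    exact List.prefix_append _ _

/-- The leading 1 prevents a run of zeros from wrapping around the end of the word. -/
theorem _root_.IsNSWord.rotations_of_head {n s : ℕ} {v : List Bool} (h : IsNSWord n s (true :: v))
    (u : List Bool) (hu : true :: v ~r u) : ¬ List.replicate (s + 1) false <+: u := by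
  intro hp
  obtain ⟨k, rfl⟩ := hu
  rw [← List.rotate_mod, List.rotate_eq_drop_append_take (Nat.mod_lt _ (by simp)).le] at hp
  generalize k % (true :: v).length = i at hp
  cases i with
  | zero => simp [List.replicate_succ] at hp
  | succ i =>
    have hb : List.replicate (s + 1) false <+: (true :: v).drop (i + 1) := by
      rcases le_or_gt (s + 1) ((true :: v).drop (i + 1)).length with hle | hgt
      · exact List.prefix_of_prefix_length_le hp (List.prefix_append _ _) (by simpa using hle)
      · have h1 := hp.getElem (i := ((true :: v).drop (i + 1)).length) (by simpa using hgt)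
        rw [List.getElem_append_right le_rfl] at h1
        simp at h1
    have := h.2 (s + 1) (hb.isInfix.trans (List.drop_suffix _ _).isInfix)
    omega

theorem _root_.IsNSWord.exists_true {n s : ℕ} {w : List Bool} (h : IsNSWord n s w) (hs : s < n) :
    ∃ j ≤ s, w[j]? = some true := by
  by_contra hne
  push Not at hne
  have : List.replicate (s + 1) false <+: w := by
    rw [List.prefix_iff_eq_take]
    refine List.ext_getElem (by simp [h.1]; omega) fun j h1 h2 => ?_
    simp only [List.length_replicate] at h1
    have := hne j (by omega)
    rw [List.getElem?_eq_getElem (by rw [h.1]; omega)] at this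
    simpa using this
  have := h.2 _ this.isInfix
  omega

/-- Past the end the entry is `none`, which counts as not being a zero. -/
theorem isNSWord_of_getElem? {n s : ℕ} {w : List Bool} (hl : w.length = n)
    (h : ∀ p, ∃ i ≤ s, w[p + i]? ≠ some false) : IsNSWord n s w := by
  refine ⟨hl, fun r hr => ?_⟩
  by_contra hlt
  obtain ⟨a, b, rfl⟩ := hr
  obtain ⟨i, hi, hne⟩ := h a.length
  apply hne
  rw [List.append_assoc, List.getElem?_append_right (by omega), Nat.add_sub_cancel_left,
    List.getElem?_append_left (by simp; omega), List.getElem?_replicate, if_pos (by omega)]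

theorem getElem?_cyclicWindow {n j : ℕ} (l : List Bool) (i : ℕ) (hj : j < n) :
    (cyclicWindow n l i)[j]? = some (l.getD ((i + j) % l.length) false) := by
  simp [cyclicWindow, hj]

theorem getElem?_acyclicWindow {n j : ℕ} (l : List Bool) (i : ℕ) (hj : j < n) :
    (acyclicWindow n l i)[j]? = l[i + j]? := by
  simp [acyclicWindow, hj]

theorem cyclicWindow_mod (n : ℕ) (l : List Bool) (i : ℕ) :
    cyclicWindow n l (i % l.length) = cyclicWindow n l i := by
  simp [cyclicWindow]

/-! ### Upper bounds on the length -/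

/-- A cyclic sequence with all the `(n,s)`-words starting with `1` among its windows is at least as
long as any set of positions that is described injectively by a number `e ≤ s` and an
`(n,s)`-word starting with `1 0^e`. -/
theorem card_le_of_windows {n s : ℕ} (hs : s < n) {l : List Bool}
    (hl : ∀ v, IsNSWord n s v → v[0]? = some true → ∃ p < l.length, cyclicWindow n l p = v)
    (P : Finset ℕ) (e : ℕ → ℕ) (W : ℕ → List Bool)
    (hP : ∀ p ∈ P, e p ≤ s ∧ IsNSWord n s (W p) ∧ (W p)[0]? = some true ∧
      ∀ i, 0 < i → i ≤ e p → (W p)[i]? = some false)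
    (hinj : ∀ p ∈ P, ∀ q ∈ P, e p = e q → W p = W q → p = q) : P.card ≤ l.length := by
  have hg : ∀ p, ∃ a, p ∈ P → a < l.length ∧ cyclicWindow n l a = W p := by
    intro p
    by_cases hp : p ∈ P
    · obtain ⟨-, h1, h2, -⟩ := hP p hp
      obtain ⟨a, ha, hw⟩ := hl _ h1 h2
      exact ⟨a, fun _ => ⟨ha, hw⟩⟩
    · exact ⟨0, fun h => absurd h hp⟩
  choose g hg using hg
  have hzero : ∀ p ∈ P, l.getD (g p % l.length) false = true := by
    intro p hp
    have h1 := (hP p hp).2.2.1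
    rw [← (hg p hp).2, getElem?_cyclicWindow l _ (by omega)] at h1
    simpa using h1
  have hsucc : ∀ p ∈ P, ∀ i, 0 < i → i ≤ e p → l.getD ((g p + i) % l.length) false = false := by
    intro p hp i h0 hi
    have h1 := (hP p hp).2.2.2 i h0 hi
    have h2 := (hP p hp).1
    rw [← (hg p hp).2, getElem?_cyclicWindow l _ (by omega)] at h1
    exact Option.some.inj h1
  -- If the images agree and e p < e q, the bit e p places back is a 1 seen from p but one of the
  -- zeros following the 1 seen from q.
  have key : ∀ p ∈ P, ∀ q ∈ P, (g p + e p) % l.length = (g q + e q) % l.length →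
      ¬ e p < e q := by
    intro p hp q hq hpq hlt
    have h1 := hsucc q hq (e q - e p) (by omega) (by omega)
    have h2 : (g p + e p) ≡ (g q + (e q - e p)) + e p [MOD l.length] := by
      have : g q + (e q - e p) + e p = g q + e q := by omega
      rw [this]; exact hpq
    have h3 := Nat.ModEq.add_right_cancel' _ h2
    rw [← (show g p % l.length = _ from h3), hzero p hp] at h1
    exact absurd h1 (by decide)
  calc P.card ≤ (Finset.range l.length).card := by
        refine Finset.card_le_card_of_injOn (fun p => (g p + e p) % l.length) ?_ ?_
        · intro p hp
          have := (hg p hp).1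
          simpa using Nat.mod_lt _ (by omega)
        · intro p hp q hq hpq
          have he : e p = e q := le_antisymm (not_lt.1 (key q hq p hp hpq.symm))
            (not_lt.1 (key p hp q hq hpq))
          refine hinj p hp q hq he ?_
          have h2 : (g p + e p) ≡ g q + e p [MOD l.length] := by
            simp only at hpq
            rw [Nat.ModEq, hpq, he]
          have h3 := (Nat.ModEq.add_right_cancel' _ h2).eq_of_lt_of_lt (hg p hp).1 (hg q hq).1
          rw [← (hg p hp).2, ← (hg q hq).2, h3]
    _ = l.length := Finset.card_range _

theorem exists_least_true {f : ℕ → Prop} {s : ℕ} (h : ∃ e ≤ s, f e) :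
    ∃ e ≤ s, f e ∧ ∀ i < e, ¬ f i := by
  classical
  obtain ⟨e, he, hf⟩ := h
  exact ⟨Nat.find ⟨e, hf⟩, (Nat.find_min' _ hf).trans he, Nat.find_spec ⟨e, hf⟩,
    fun i hi => Nat.find_min _ hi⟩

theorem _root_.IsCyclicNSSequence.length_le {n s : ℕ} (hs : s < n) {l l' : List Bool}
    (hl : ∀ v, IsNSWord n s v → v[0]? = some true → ∃ p < l.length, cyclicWindow n l p = v)
    (h : IsCyclicNSSequence n s l') : l'.length ≤ l.length := by
  rcases Nat.eq_zero_or_pos l'.length with h0 | hpos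
  · omega
  set K := l'.length with hK
  -- Adding the multiple K * s of the period keeps the backward steps of at most s clear of
  -- truncated subtraction.
  have hKs : s ≤ K * s := Nat.le_mul_of_pos_left s hpos
  have hex : ∀ p, ∃ e ≤ s, l'.getD ((p + K * s - e) % K) false = true ∧
      ∀ i < e, ¬ l'.getD ((p + K * s - i) % K) false = true := by
    intro p
    refine exists_least_true ?_
    have h1 := h.1 ((p + K * s - s) % K) (Nat.mod_lt _ hpos)
    obtain ⟨j, hj, hw⟩ := h1.exists_true hs
    rw [cyclicWindow_mod, getElem?_cyclicWindow l' _ (by omega)] at hw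
    refine ⟨s - j, by omega, ?_⟩
    have : p + K * s - (s - j) = p + K * s - s + j := by omega
    rw [this]
    exact Option.some.inj hw
  choose e he htrue hfalse using hex
  have hb := card_le_of_windows hs hl (Finset.range K) e
    (fun p => cyclicWindow n l' ((p + K * s - e p) % K)) ?_ ?_
  · simpa using hb
  · intro p _
    have h1 := he p
    refine ⟨he p, h.1 _ (Nat.mod_lt _ hpos), ?_, fun i h0 hi => ?_⟩
    · rw [cyclicWindow_mod, getElem?_cyclicWindow l' _ (by omega)]
      exact congrArg some (htrue p)
    · rw [cyclicWindow_mod, getElem?_cyclicWindow l' _ (by omega)]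
      have h2 := hfalse p (e p - i) (by omega)
      have : p + K * s - (e p - i) = p + K * s - e p + i := by omega
      rw [this] at h2
      exact congrArg some (by simpa using h2)
  · intro p hp q hq hpq hw
    have h1 := h.2 _ (Nat.mod_lt _ hpos) _ (Nat.mod_lt _ hpos) hw
    have h2 : p + K * s - e p ≡ q + K * s - e p [MOD K] := by
      rw [← hpq] at h1; exact h1
    have h3 := h2.add_right (e p)
    have hep := he p
    have h4 : ∀ x, x + K * s - e p + e p = x + K * s := fun x => by omega
    rw [h4, h4] at h3
    have h5 := Nat.ModEq.add_right_cancel' _ h3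
    exact h5.eq_of_lt_of_lt (Finset.mem_range.1 hp) (Finset.mem_range.1 hq)

theorem _root_.IsAcyclicNSSequence.length_le {n s : ℕ} (hs : s < n) {l l' : List Bool}
    (hl : ∀ v, IsNSWord n s v → v[0]? = some true → ∃ p < l.length, cyclicWindow n l p = v)
    (h : IsAcyclicNSSequence n s l') : l'.length ≤ l.length + s + (n - 1) := by
  rcases lt_or_ge l'.length n with hlt | hge
  · omega
  -- Only window positions from z on are counted, so that a 1 at or before them exists; since z ≤ s,
  -- at most s are lost.
  obtain ⟨z, hz, hzw⟩ := (h.1 0 (by omega)).exists_true hs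
  rw [getElem?_acyclicWindow l' _ (by omega), Nat.zero_add] at hzw
  have hex : ∀ p, ∃ e ≤ s, z ≤ p → p + n ≤ l'.length →
      e ≤ p ∧ l'[p - e]? = some true ∧ ∀ i < e, ¬ (i ≤ p ∧ l'[p - i]? = some true) := by
    intro p
    by_cases hp : z ≤ p ∧ p + n ≤ l'.length
    · obtain ⟨e, he, h1, h2⟩ := exists_least_true (s := s)
        (f := fun e => e ≤ p ∧ l'[p - e]? = some true) (by
          rcases lt_or_ge p s with hps | hps
          · exact ⟨p - z, by omega, by omega, by rwa [Nat.sub_sub_self hp.1]⟩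
          · obtain ⟨j, hj, hw⟩ := (h.1 (p - s) (by omega)).exists_true hs
            rw [getElem?_acyclicWindow l' _ (by omega)] at hw
            refine ⟨s - j, by omega, by omega, ?_⟩
            have : p - (s - j) = p - s + j := by omega
            rwa [this])
      exact ⟨e, he, fun _ _ => ⟨h1.1, h1.2, h2⟩⟩
    · exact ⟨0, by omega, fun h1 h2 => absurd ⟨h1, h2⟩ hp⟩
  choose e he hprop using hex
  have hb := card_le_of_windows hs hl (Finset.Ico z (l'.length - n + 1)) e
    (fun p => acyclicWindow n l' (p - e p)) ?_ ?_
  · rw [Nat.card_Ico] at hb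
    omega
  · intro p hp
    rw [Finset.mem_Ico] at hp
    obtain ⟨h1, h2, h3⟩ := hprop p hp.1 (by omega)
    have h4 := he p
    refine ⟨he p, h.1 _ (by omega), ?_, fun i h0 hi => ?_⟩
    · rw [getElem?_acyclicWindow l' _ (by omega)]
      exact h2
    · rw [getElem?_acyclicWindow l' _ (by omega)]
      have h5 := h3 (e p - i) (by omega)
      have : p - (e p - i) = p - e p + i := by omega
      rw [this, List.getElem?_eq_getElem (by omega)] at h5
      rw [List.getElem?_eq_getElem (by omega)]
      have h6 : ¬ l'[p - e p + i] = true := fun h7 => h5 ⟨by omega, by rw [h7]⟩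
      simpa using h6
  · intro p hp q hq hpq hw
    rw [Finset.mem_Ico] at hp hq
    obtain ⟨h1, -⟩ := hprop p hp.1 (by omega)
    obtain ⟨h2, -⟩ := hprop q hq.1 (by omega)
    have := h.2 _ _ (by omega) (by omega) hw
    omega

/-! ### The two sequences -/

theorem IsRootList.isWindow_iff {n s : ℕ} (hs : s < n) {X : List (List Bool)}
    (h : IsRootList n s X) (v : List Bool) :
    (∃ p < X.flatten.length, cyclicWindow n X.flatten p = v) ↔
      v.length = n ∧ ∀ u, v ~r u → ¬ List.replicate (s + 1) false <+: u := by
  have hn : 0 < n := by omega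
  rw [(h.isUpper hn).exists_cyclicWindow_iff hn, h.exists_isRotated_iff hs]

theorem IsRootList.exists_window {n s : ℕ} (hs : s < n) {X : List (List Bool)}
    (h : IsRootList n s X) (v : List Bool) (hv : IsNSWord n s v) (h0 : v[0]? = some true) :
    ∃ p < X.flatten.length, cyclicWindow n X.flatten p = v := by
  rw [h.isWindow_iff hs]
  refine ⟨hv.1, ?_⟩
  cases v with
  | nil => simp at h0
  | cons b v =>
    obtain rfl : b = true := by simpa using h0
    exact hv.rotations_of_head

theorem IsRootList.isCyclicNSSequence {n s : ℕ} (hs : s < n) {X : List (List Bool)}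
    (h : IsRootList n s X) : IsCyclicNSSequence n s X.flatten := by
  have hn : 0 < n := by omega
  refine ⟨fun i hi => ?_, fun i hi j hj hij => (h.isUpper hn).cyclicWindow_injOn hn hi hj hij⟩
  obtain ⟨h1, h2⟩ := (h.isWindow_iff hs (cyclicWindow n X.flatten i)).1 ⟨i, hi, rfl⟩
  exact isNSWord_of_rotations h1 h2

/-- The necklace 0^s1^{n-s} is listed, so the first necklace is at most it and must also start with
0^s. -/
theorem IsRootList.zeros_prefix {n s : ℕ} (hs : s < n) {X : List (List Bool)}
    (h : IsRootList n s X) : List.replicate s false <+: X.flatten := by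
  have hn : 0 < n := by omega
  rcases Nat.eq_zero_or_pos s with rfl | hs0
  · exact List.nil_prefix
  have hI : initialWord n s =
      List.replicate s false ++ false :: List.replicate (n - s - 1) true := by
    rw [initialWord, List.replicate_succ']; simp
  set w := List.replicate s false ++ true :: List.replicate (n - s - 1) true with hw
  have hlt : initialWord n s < w := by
    rw [hI]; exact append_false_lt_append_true _ _ _
  have hN : IsNeck w := (hI ▸ isPre_initialWord n s).isNeck_increment _
  obtain ⟨V, hV, hVw⟩ := h.2.2 w (by simp [hw]; omega) hN hlt
  have hU := h.isUpper hn
  cases X with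
  | nil => simp at hV
  | cons Z X =>
    have hle : ext n Z ≤ w := by
      rw [← hVw]
      rcases List.mem_cons.1 hV with rfl | hV
      · exact le_rfl
      · exact (hU.ext_lt hn hV).le
    have hZ := hU.2.1 Z (by simp)
    have h1 := take_le_take_of_le hle s
    rw [hw, List.take_left' List.length_replicate] at h1
    have h2 := eq_replicate_false_of_le
      (by rw [List.length_take, length_ext hZ.1.1]; omega) h1
    have hpre : List.replicate s false <+: ext n Z := h2 ▸ List.take_prefix _ _
    refine hpre.trans (hU.ext_prefix_flatten hn fun h3 => ?_)
    have : false ∈ List.replicate n true :=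
      h3 ▸ hpre.subset (List.mem_replicate.2 ⟨by omega, rfl⟩)
    exact absurd (List.eq_of_mem_replicate this) (by decide)

/-- The word 1^m l 0^s is the cyclic sequence [l] read from m places before its start; modulo |l|,
the shift m(|l| - 1) is -m. The all-ones alternative covers an l shorter than m. -/
theorem getElem?_append_periodic {m s : ℕ} {l : List Bool} (hl : l ≠ [])
    (hzero : List.replicate s false <+: l)
    (hone : (∀ x ∈ l, x = true) ∨ List.replicate m true <:+ l) {k : ℕ}
    (hk : k < m + l.length + s) :
    (List.replicate m true ++ (l ++ List.replicate s false))[k]? =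
      some (l.getD ((k + m * (l.length - 1)) % l.length) false) := by
  have hpos := List.length_pos_iff.2 hl
  obtain ⟨L, hL⟩ : ∃ L, l.length = L + 1 := ⟨l.length - 1, by omega⟩
  have hmod := Nat.mod_lt (k + m * (l.length - 1)) hpos
  rcases lt_or_ge k m with hkm | hkm
  · rw [List.getElem?_append_left (by simpa using hkm), List.getElem?_replicate, if_pos hkm,
      List.getD_eq_getElem _ _ hmod]
    congr 1
    symm
    rcases hone with hone | ⟨c, hc⟩
    · exact hone _ (List.getElem_mem _)
    · have hcl : c.length + m = l.length := by rw [← hc]; simp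
      have : (k + m * (l.length - 1)) % l.length = c.length + k := by
        obtain ⟨q, rfl⟩ : ∃ q, m = q + 1 := ⟨m - 1, by omega⟩
        have : k + (q + 1) * (l.length - 1) = (c.length + k) + l.length * q := by
          have hcL : c.length + q = L := by omega
          rw [hL, Nat.add_sub_cancel]
          nlinarith
        rw [this, Nat.add_mul_mod_self_left, Nat.mod_eq_of_lt (by omega)]
      simp only [this]
      simp only [← hc]
      rw [List.getElem_append_right (by omega)]
      simp
  · obtain ⟨q, rfl⟩ := Nat.exists_eq_add_of_le hkm
    have hq : (m + q + m * (l.length - 1)) % l.length = q % l.length := by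
      have : m + q + m * (l.length - 1) = q + l.length * m := by
        rw [hL, Nat.add_sub_cancel]; ring
      rw [this, Nat.add_mul_mod_self_left]
    rw [hq, List.getElem?_append_right (by simp), List.length_replicate, Nat.add_sub_cancel_left]
    rcases lt_or_ge q l.length with hql | hql
    · rw [Nat.mod_eq_of_lt hql, List.getElem?_append_left hql, List.getD_eq_getElem _ _ hql,
        List.getElem?_eq_getElem hql]
    · have hsl : s ≤ l.length := by simpa using hzero.length_le
      obtain ⟨q, rfl⟩ := Nat.exists_eq_add_of_le hql
      have hqs : q < s := by omega
      rw [List.getElem?_append_right (by omega), Nat.add_sub_cancel_left, Nat.add_mod_left,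
        Nat.mod_eq_of_lt (by omega), List.getD_eq_getElem _ _ (by omega),
        List.getElem?_replicate, if_pos hqs, ← hzero.getElem (by simpa using hqs),
        List.getElem_replicate]

theorem isNSWord_zeros_ones_zeros {a m b s : ℕ} (ha : a ≤ s) (hb : b ≤ s) (hm : 0 < m)
    (hab : a + b = s + 1) :
    IsNSWord (a + m + b) s
      (List.replicate a false ++ (List.replicate m true ++ List.replicate b false)) := by
  have htrue : ∀ i < m,
      (List.replicate a false ++ (List.replicate m true ++ List.replicate b false))[a + i]? =
        some true := by
    intro i hi
    rw [List.getElem?_append_right (by simp), List.length_replicate, Nat.add_sub_cancel_left,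
      List.getElem?_append_left (by simpa using hi), List.getElem?_replicate, if_pos hi]
  refine isNSWord_of_getElem? (by simp; omega) fun p => ?_
  rcases le_or_gt p a with hp | hp
  · refine ⟨a - p, by omega, ?_⟩
    have h := htrue 0 hm
    rw [Nat.add_zero] at h
    rw [Nat.add_sub_cancel' hp, h]
    simp
  · rcases lt_or_ge p (a + m) with hpm | hpm
    · refine ⟨0, by omega, ?_⟩
      have h := htrue (p - a) (by omega)
      rw [Nat.add_sub_cancel' hp.le] at h
      rw [Nat.add_zero, h]
      simp
    · refine ⟨s, le_rfl, ?_⟩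
      rw [List.getElem?_eq_none (by simp; omega)]
      simp

theorem acyclicWindow_initial {m s i : ℕ} {l : List Bool} (hi : i < s)
    (hzero : List.replicate s false <+: l) :
    acyclicWindow (s - i + m + (i + 1))
      (List.replicate s false ++ List.replicate m true ++ l ++ List.replicate s false) i =
      List.replicate (s - i) false ++
        (List.replicate m true ++ List.replicate (i + 1) false) := by
  obtain ⟨c, rfl⟩ := hzero
  have h1 : List.replicate s false = List.replicate i false ++ List.replicate (s - i) false := by
    rw [List.replicate_append_replicate]; congr 1; omega
  have h2 : List.replicate s false =
      List.replicate (i + 1) false ++ List.replicate (s - (i + 1)) false := by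
    rw [List.replicate_append_replicate]; congr 1; omega
  have : List.replicate s false ++ List.replicate m true ++ (List.replicate s false ++ c) ++
      List.replicate s false = List.replicate i false ++ ((List.replicate (s - i) false ++
        (List.replicate m true ++ List.replicate (i + 1) false)) ++
          (List.replicate (s - (i + 1)) false ++ c ++ List.replicate s false)) := by
    conv_lhs =>
      arg 1
      congr
      · rw [h1]
      · rw [h2]
    simp only [List.append_assoc]
  rw [acyclicWindow, this, List.drop_left' (by simp), List.take_left' (by simp; omega)]

theorem IsRootList.isAcyclicNSSequence {n s : ℕ} (hs : s + 1 < n) {X : List (List Bool)}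
    (h : IsRootList n s X) :
    IsAcyclicNSSequence n s
      (List.replicate s false ++ List.replicate (n - s - 1) true ++ X.flatten ++
        List.replicate s false) := by
  have hn : 0 < n := by omega
  have hsn : s < n := by omega
  obtain ⟨m, rfl⟩ : ∃ m, n = s + 1 + (m + 1) := ⟨n - s - 2, by omega⟩
  have hm : s + 1 + (m + 1) - s - 1 = m + 1 := by omega
  rw [hm]
  have hcyc := h.isCyclicNSSequence hsn
  have hzero := h.zeros_prefix hsn
  have hone : (∀ x ∈ X.flatten, x = true) ∨ List.replicate (m + 1) true <:+ X.flatten := by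
    refine ((h.isUpper hn).all_true_or_ones_suffix hn).imp id fun h1 => ?_
    refine List.IsSuffix.trans ?_ h1
    exact ⟨List.replicate (s + 1) true, by rw [List.replicate_append_replicate]⟩
  have hwin := h.isWindow_iff hsn
  have hne : X.flatten ≠ [] := by
    obtain ⟨p, hp, -⟩ := (hwin (List.replicate (s + 1 + (m + 1)) true)).2
      ⟨by simp, fun u hu hp => by
      obtain ⟨k, rfl⟩ := hu
      rw [List.rotate_replicate] at hp
      have : false ∈ List.replicate (s + 1 + (m + 1)) true := hp.subset (by simp)
      exact absurd (List.eq_of_mem_replicate this) (by decide)⟩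
    exact List.length_pos_iff.1 (by omega)
  set l := X.flatten with hl
  set A := List.replicate s false ++ List.replicate (m + 1) true ++ l ++ List.replicate s false
    with hA
  have hpos := List.length_pos_iff.2 hne
  have hAl : A.length = s + (m + 1) + l.length + s := by
    simp [hA]; omega
  have hfirst : ∀ i < s, acyclicWindow (s + 1 + (m + 1)) A i =
      List.replicate (s - i) false ++
        (List.replicate (m + 1) true ++ List.replicate (i + 1) false) := by
    intro i hi
    have := acyclicWindow_initial (m := m + 1) hi hzero
    rwa [show s - i + (m + 1) + (i + 1) = s + 1 + (m + 1) by omega] at this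
  have hrest : ∀ q < l.length, acyclicWindow (s + 1 + (m + 1)) A (s + q) =
      cyclicWindow (s + 1 + (m + 1)) l ((q + (m + 1) * (l.length - 1)) % l.length) := by
    intro q hq
    refine List.ext_getElem? fun j => ?_
    rcases lt_or_ge j (s + 1 + (m + 1)) with hj | hj
    · rw [getElem?_acyclicWindow A _ hj, cyclicWindow_mod, getElem?_cyclicWindow l _ hj, hA,
        List.append_assoc, List.append_assoc, List.getElem?_append_right (by simp; omega),
        List.length_replicate, show s + q + j - s = q + j by omega,
        getElem?_append_periodic hne hzero hone (by omega)]
      congr 3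
      omega
    · rw [List.getElem?_eq_none (by simp [acyclicWindow]; omega),
        List.getElem?_eq_none (by simp [cyclicWindow]; omega)]
  -- Each of the first s windows has a rotation starting with 0^{s+1}, so it is not a cyclic window
  -- of l.
  have hdiff : ∀ i < s, ∀ q < l.length, acyclicWindow (s + 1 + (m + 1)) A i ≠
      acyclicWindow (s + 1 + (m + 1)) A (s + q) := by
    intro i hi q hq heq
    rw [hfirst i hi, hrest q hq] at heq
    refine ((hwin _).1 ⟨_, Nat.mod_lt _ hpos, heq.symm⟩).2
      (List.replicate (i + 1) false ++
        (List.replicate (s - i) false ++ List.replicate (m + 1) true)) ?_ ?_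
    · rw [← List.append_assoc]
      exact List.isRotated_append
    · rw [← List.append_assoc, List.replicate_append_replicate,
        show i + 1 + (s - i) = s + 1 by omega]
      exact List.prefix_append _ _
  have hfirst_inj : ∀ i < s, ∀ j < s, acyclicWindow (s + 1 + (m + 1)) A i =
      acyclicWindow (s + 1 + (m + 1)) A j → ¬ i < j := by
    intro i hi j hj heq hlt
    rw [hfirst i hi, hfirst j hj] at heq
    -- For i < j, the bit at index s - j is still 0 in window i but is the first 1 of window j.
    have := congrArg (·[s - j]?) heq
    beta_reduce at this
    rw [List.getElem?_append_left (by simp; omega), List.getElem?_append_right (by simp),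
      List.getElem?_replicate, if_pos (by omega), List.length_replicate, Nat.sub_self,
      List.replicate_succ] at this
    simp at this
  refine ⟨fun i hi => ?_, fun i j hi hj hij => ?_⟩
  · rcases lt_or_ge i s with his | his
    · rw [hfirst i his]
      have := isNSWord_zeros_ones_zeros (a := s - i) (m := m + 1) (b := i + 1) (s := s)
        (by omega) (by omega) (by omega) (by omega)
      rwa [show s - i + (m + 1) + (i + 1) = s + 1 + (m + 1) by omega] at this
    · obtain ⟨q, rfl⟩ := Nat.exists_eq_add_of_le his
      rw [hrest q (by omega)]
      exact hcyc.1 _ (Nat.mod_lt _ hpos)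
  · rcases lt_or_ge i s with his | his <;> rcases lt_or_ge j s with hjs | hjs
    · exact le_antisymm (not_lt.1 (hfirst_inj j hjs i his hij.symm))
        (not_lt.1 (hfirst_inj i his j hjs hij))
    · obtain ⟨q, rfl⟩ := Nat.exists_eq_add_of_le hjs
      exact absurd hij (hdiff i his q (by omega))
    · obtain ⟨q, rfl⟩ := Nat.exists_eq_add_of_le his
      exact absurd hij.symm (hdiff j hjs q (by omega))
    · obtain ⟨p, rfl⟩ := Nat.exists_eq_add_of_le his
      obtain ⟨q, rfl⟩ := Nat.exists_eq_add_of_le hjs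
      rw [hrest p (by omega), hrest q (by omega)] at hij
      have h1 : p + (m + 1) * (l.length - 1) ≡ q + (m + 1) * (l.length - 1) [MOD l.length] :=
        hcyc.2 _ (Nat.mod_lt _ hpos) _ (Nat.mod_lt _ hpos) hij
      have h2 := (Nat.ModEq.add_right_cancel' _ h1).eq_of_lt_of_lt (by omega) (by omega)
      rw [h2]

end BinWord

open BinWord in
theorem mainTheorem7 (n s : ℕ) (hs : s < n) :
    ∃ X : List (List Bool),
      AlgorithmComputes n s X ∧
      (X.Pairwise (· < ·) ∧
        ∀ x, x ∈ X ↔ IsLyndonWordOfOrder n x ∧ initialWord n s < x) ∧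
      IsMaxCyclicNSSequence n s X.flatten ∧
      (s + 1 < n →
        IsMaxAcyclicNSSequence n s
          (List.replicate s false ++ List.replicate (n - s - 1) true ++ X.flatten ++
            List.replicate s false)) := by
  have hn : 0 < n := by omega
  obtain ⟨t, X, h1, h2, h3⟩ :=
    exists_run n (initialWord n s) [] (length_initialWord hs) (isPre_initialWord n s)
  have h : IsRootList n s X := h3
  refine ⟨X, ⟨t, h1, h2⟩, ⟨h.pairwise_lt hn, h.mem_iff hn⟩,
    ⟨h.isCyclicNSSequence hs, fun l' hl' => hl'.length_le hs (h.exists_window hs)⟩,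
    fun hs' => ⟨h.isAcyclicNSSequence hs', fun l' hl' => ?_⟩⟩
  refine (hl'.length_le hs (h.exists_window hs)).trans ?_
  simp only [List.length_append, List.length_replicate]
  omega
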